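/- **Theorem 4.1.** Let $T>0$, let $X$ be a real Banach space and $Y$ a real Hilbert space with dual $Y^*$ and dual pairing $\langle\cdot,\cdot\rangle_Y$. Write $H^1_0(0,T;Y):=\{y\in H^1(0,T;Y): y(0)=0\}$ (no condition at $T$), and let $\dot y$ denote the weak derivative. Suppose the following. (1) $A\in\mathcal L(Y,Y)$ is self-adjoint and there is $\alpha>0$ with $(Ay,y)_Y\ge\alpha\|y\|_Y^2$ for all $y\in Y$. For a load $\ell:[0,T]\to Y^*$ the energy is $\mathcal E(t,q):=\tfrac12(Aq,q)_Y-\langle\ell(t),q\rangle_Y$. (2) $\mathcal R:X\times Y\to[0,\infty]$ is such that, for each $\zeta\in X$, $\mathcal R(\zeta,\cdot)$ is proper, convex, lower semicontinuous and positively homogeneous, i.e. $\mathcal R(\zeta,\gamma\eta)=\gamma\mathcal R(\zeta,\eta)$ for all $\gamma\ge0$, $\eta\in Y$ (with $0\cdot\infty=0$); its domain $\{\eta\in Y:\mathcal R(\zeta,\eta)<\infty\}$ is a set $\operatorname{dom}\mathcal R\subset Y$ independent of $\zeta$; and there is $L_{\mathcal R}\ge0$ such that for all $\zeta_1,\zeta_2\in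 X$ and $\eta_1,\eta_2\in\operatorname{dom}\mathcal R$ $$\mathcal R(\zeta_1,\eta_2)-\mathcal R(\zeta_1,\eta_1)+\mathcal R(\zeta_2,\eta_1)-\mathcal R(\zeta_2,\eta_2)\le L_{\mathcal R}\|\zeta_1-\zeta_2\|_X\|\eta_1-\eta_2\|_Y .$$ (3) $B\in W^{1,1}(0,T;\mathcal L(Y,X))$, $y_0\in X$, and $\mathcal H(y)(t):=\int_0^tB(t-s)y(s)\,ds+y_0$ for $y\in L^1(0,T;Y)$, $t\in[0,T]$. (4) $\operatorname{dom}\mathcal R$ is closed. Let $\mathcal Y:=\{y\in H^1_0(0,T;Y):\dot y(t)\in\operatorname{dom}\mathcal R\text{ for a.a. }t\in(0,T)\}$. Whenever $\{y_m\}\subset\mathcal Y$ and $y_m\rightharpoonup y$ weakly in $H^1_0(0,T;Y)$, then $$\liminf_{m\to\infty}\int_0^T\mathcal R(\mathcal H(y_m)(t),\dot y_m(t))\,dt\ge\int_0^T\mathcal R(\mathcal H(y)(t),\dot y(t))\,dt ,$$ and for each $v\in\mathcal Y$ there is a sequence $\{v_m\}\subset\mathcal Y$ with $v_m\to v$ in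 $H^1_0(0,T;Y)$ and $$\limsup_{m\to\infty}\int_0^T\mathcal R(\mathcal H(y_m)(t),\dot v_m(t))\,dt\le\int_0^T\mathcal R(\mathcal H(y)(t),\dot v(t))\,dt .$$ Let $\partial_2\mathcal R(\zeta,\eta)\subset Y^*$ be the convex subdifferential of $\mathcal R(\zeta,\cdot)$ at $\eta$. Then for every $\ell\in H^1(0,T;Y^*)$ (identified with its continuous representative on $[0,T]$) that satisfies the compatibility condition $\ell(0)\in\partial_2\mathcal R(y_0,0)$, there is at least one $q\in H^1_0(0,T;Y)$ (so $q(0)=0$) such that $$-\partial_q\mathcal E(t,q(t))\in\partial_2\mathcal R(\mathcal H(q)(t),\dot q(t))\quad\text{in }Y^*\text{ for a.a. }t\in(0,T).$$ -/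

import Mathlib

open MeasureTheory Filter Topology
open scoped ENNReal NNReal ContDiff

noncomputable section

/-! ### Bochner-Sobolev spaces on the interval `(0,T)` -/

/-- Lebesgue measure on the open interval `(0,T)`. -/
abbrev timeMeasure (T : ℝ) : Measure ℝ := volume.restrict (Set.Ioo 0 T)

/-- `v` is the weak derivative of `u` on `(0,T)`: the integration by parts formula holds against
all smooth functions compactly supported in `(0,T)`. -/
def HasWeakDeriv {E : Type*} [NormedAddCommGroup E] [NormedSpace ℝ E]
    (T : ℝ) (u v : ℝ → E) : Prop :=
  ∀ φ : ℝ → ℝ, ContDiff ℝ ∞ φ → HasCompactSupport φ → tsupport φ ⊆ Set.Ioo 0 T →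
    ∫ t, deriv φ t • u t ∂(timeMeasure T) = -∫ t, φ t • v t ∂(timeMeasure T)

theorem integrable_smul_of_Lp {E : Type*} [NormedAddCommGroup E] [NormedSpace ℝ E]
    {p : ℝ≥0∞} [Fact (1 ≤ p)] {T : ℝ} (u : Lp E p (timeMeasure T)) {ψ : ℝ → ℝ}
    (hψ : Continuous ψ) (hc : HasCompactSupport ψ) :
    Integrable (fun t => ψ t • u t) (timeMeasure T) := by
  obtain ⟨C, hC⟩ := hc.exists_bound_of_continuous hψ
  exact ((Lp.memLp u).integrable Fact.out).bdd_smul C hψ.aestronglyMeasurable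
    (Eventually.of_forall hC)

/-- The Sobolev space `W^{1,p}(0,T;E)`: all `u ∈ L^p(0,T;E)` that have a weak derivative
`v ∈ L^p(0,T;E)`, recorded as the pair `(u, v)` and normed by `(‖u‖^p + ‖v‖^p)^{1/p}`.
(`v` is determined by `u`.) -/
def sobolevW1 (p : ℝ≥0∞) [Fact (1 ≤ p)] (T : ℝ)
    (E : Type*) [NormedAddCommGroup E] [NormedSpace ℝ E] :
    Submodule ℝ (WithLp p (Lp E p (timeMeasure T) × Lp E p (timeMeasure T))) where
  carrier := {w | HasWeakDeriv T w.fst w.snd}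
  add_mem' := by
    intro a b ha hb φ hφ hc hs
    have hd : Continuous (deriv φ) := hφ.continuous_deriv (by simp)
    have hcd : HasCompactSupport (deriv φ) := hc.deriv
    have h1 : ∫ t, deriv φ t • (a + b).fst t ∂(timeMeasure T)
        = ∫ t, (deriv φ t • a.fst t + deriv φ t • b.fst t) ∂(timeMeasure T) := by
      apply integral_congr_ae
      filter_upwards [Lp.coeFn_add a.fst b.fst] with t ht
      rw [← smul_add]
      exact congrArg _ ht
    have h2 : ∫ t, φ t • (a + b).snd t ∂(timeMeasure T)
        = ∫ t, (φ t • a.snd t + φ t • b.snd t) ∂(timeMeasure T) := by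
      apply integral_congr_ae
      filter_upwards [Lp.coeFn_add a.snd b.snd] with t ht
      rw [← smul_add]
      exact congrArg _ ht
    rw [h1, h2, integral_add (integrable_smul_of_Lp _ hd hcd) (integrable_smul_of_Lp _ hd hcd),
      integral_add (integrable_smul_of_Lp _ hφ.continuous hc)
        (integrable_smul_of_Lp _ hφ.continuous hc), ha φ hφ hc hs, hb φ hφ hc hs, neg_add]
  zero_mem' := by
    intro φ _ _ _
    have h1 : ∫ t, deriv φ t •
        (0 : WithLp p (Lp E p (timeMeasure T) × Lp E p (timeMeasure T))).fst t
          ∂(timeMeasure T) = ∫ _, (0 : E) ∂(timeMeasure T) := by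
      apply integral_congr_ae
      filter_upwards [Lp.coeFn_zero E p (timeMeasure T)] with t ht
      exact (congrArg _ ht).trans (smul_zero _)
    have h2 : ∫ t, φ t •
        (0 : WithLp p (Lp E p (timeMeasure T) × Lp E p (timeMeasure T))).snd t
          ∂(timeMeasure T) = ∫ _, (0 : E) ∂(timeMeasure T) := by
      apply integral_congr_ae
      filter_upwards [Lp.coeFn_zero E p (timeMeasure T)] with t ht
      exact (congrArg _ ht).trans (smul_zero _)
    rw [h1, h2]
    simp
  smul_mem' := by
    intro r a ha φ hφ hc hs
    have h1 : ∫ t, deriv φ t • (r • a).fst t ∂(timeMeasure T)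
        = ∫ t, r • (deriv φ t • a.fst t) ∂(timeMeasure T) := by
      apply integral_congr_ae
      filter_upwards [Lp.coeFn_smul r a.fst] with t ht
      rw [smul_comm]
      exact congrArg _ ht
    have h2 : ∫ t, φ t • (r • a).snd t ∂(timeMeasure T)
        = ∫ t, r • (φ t • a.snd t) ∂(timeMeasure T) := by
      apply integral_congr_ae
      filter_upwards [Lp.coeFn_smul r a.snd] with t ht
      rw [smul_comm]
      exact congrArg _ ht
    rw [h1, h2, integral_smul, integral_smul, ha φ hφ hc hs, smul_neg]

/-- The function `f` belongs to `H^1(0,T;E) = W^{1,2}(0,T;E)`. -/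
def MemH1 {E : Type*} [NormedAddCommGroup E] [NormedSpace ℝ E] (T : ℝ) (f : ℝ → E) : Prop :=
  ∃ w ∈ sobolevW1 2 T E, w.fst =ᵐ[timeMeasure T] f

/-- The Hilbert space `H^1_0(0,T;E)` of all `y ∈ H^1(0,T;E)` with `y(0) = 0`, where the initial
value is that of the representative of `y` that is continuous on `[0,T]`. No condition is imposed
at `T`. An element is a pair `(y, ẏ)`. -/
def sobolevH10 (T : ℝ) (E : Type*) [NormedAddCommGroup E] [NormedSpace ℝ E] :
    Submodule ℝ (WithLp 2 (Lp E 2 (timeMeasure T) × Lp E 2 (timeMeasure T))) where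
  carrier := {w | w ∈ sobolevW1 2 T E ∧
    ∃ c : ℝ → E, ContinuousOn c (Set.Icc 0 T) ∧ w.fst =ᵐ[timeMeasure T] c ∧ c 0 = 0}
  add_mem' := by
    rintro a b ⟨ha, c, hc, hac, hc0⟩ ⟨hb, d, hd, hbd, hd0⟩
    refine ⟨Submodule.add_mem _ ha hb, fun t => c t + d t, hc.add hd, ?_, by simp [hc0, hd0]⟩
    filter_upwards [Lp.coeFn_add a.fst b.fst, hac, hbd] with t ht h1 h2
    refine Eq.trans ht ?_
    simp [h1, h2]
  zero_mem' := ⟨Submodule.zero_mem _, fun _ => 0, continuousOn_const,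
    Lp.coeFn_zero E 2 (timeMeasure T), rfl⟩
  smul_mem' := by
    rintro r a ⟨ha, c, hc, hac, hc0⟩
    refine ⟨Submodule.smul_mem _ r ha, fun t => r • c t, hc.const_smul r, ?_, by simp [hc0]⟩
    filter_upwards [Lp.coeFn_smul r a.fst, hac] with t ht h1
    refine Eq.trans ht ?_
    simp [h1]

/-- The values of `y ∈ H^1_0(0,T;E)` (defined for almost all times). -/
def h10Val {T : ℝ} {E : Type*} [NormedAddCommGroup E] [NormedSpace ℝ E]
    (y : sobolevH10 T E) : ℝ → E := y.1.fst

/-- The weak derivative `ẏ ∈ L^2(0,T;E)` of `y ∈ H^1_0(0,T;E)`. -/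
def h10Rate {T : ℝ} {E : Type*} [NormedAddCommGroup E] [NormedSpace ℝ E]
    (y : sobolevH10 T E) : ℝ → E := y.1.snd

/-! ### Energy, dissipation, history operator -/

/-- The convex subdifferential of `f : Y → [-∞,∞]` at `y`. -/
def convexSubdiff {Y : Type*} [NormedAddCommGroup Y] [NormedSpace ℝ Y]
    (f : Y → EReal) (y : Y) : Set (StrongDual ℝ Y) :=
  {ξ | ∀ v : Y, f y + ((ξ (v - y) : ℝ) : EReal) ≤ f v}

/-- The partial subdifferential `∂₂R(ζ,η)` of `R : X × Y → [0,∞]`. -/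
def subdiffTwo {X Y : Type*} [NormedAddCommGroup Y] [NormedSpace ℝ Y]
    (R : X → Y → ℝ≥0∞) (ζ : X) (η : Y) : Set (StrongDual ℝ Y) :=
  convexSubdiff (fun v => (R ζ v : EReal)) η

/-- The quadratic energy `E(t,q) = ½ (A q, q) - ⟨ℓ(t), q⟩`. -/
def energy {Y : Type*} [NormedAddCommGroup Y] [InnerProductSpace ℝ Y]
    (A : Y →L[ℝ] Y) (l : ℝ → StrongDual ℝ Y) (t : ℝ) (q : Y) : ℝ :=
  (1 / 2 : ℝ) * inner ℝ (A q) q - l t q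

/-- The standing assumptions on the dissipation functional `R : X × Y → [0,∞]`, whose partial
functionals `R(ζ, ·)` all have the same domain `D`. -/
structure IsDissipation {X Y : Type*} [NormedAddCommGroup X] [NormedSpace ℝ X]
    [NormedAddCommGroup Y] [NormedSpace ℝ Y] (R : X → Y → ℝ≥0∞) (D : Set Y) : Prop where
  proper : ∀ ζ, ∃ η, R ζ η ≠ ⊤
  convex : ∀ ζ, ∀ η₁ η₂ : Y, ∀ a b : ℝ≥0, a + b = 1 →
    R ζ (a • η₁ + b • η₂) ≤ a * R ζ η₁ + b * R ζ η₂
  lowerSemicontinuous : ∀ ζ, LowerSemicontinuous (R ζ)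
  posHomogeneous : ∀ ζ, ∀ γ : ℝ≥0, ∀ η : Y, R ζ (γ • η) = γ * R ζ η
  domain_eq : ∀ ζ, {η | R ζ η < ⊤} = D
  mixedLipschitz : ∃ L : ℝ, 0 ≤ L ∧ ∀ ζ₁ ζ₂ : X, ∀ η₁ ∈ D, ∀ η₂ ∈ D,
    (R ζ₁ η₂).toReal - (R ζ₁ η₁).toReal + (R ζ₂ η₁).toReal - (R ζ₂ η₂).toReal
      ≤ L * ‖ζ₁ - ζ₂‖ * ‖η₁ - η₂‖

/-- The history operator `H(y)(t) = ∫₀ᵗ B(t-s) y(s) ds + y₀` with kernel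
`B ∈ W^{1,1}(0,T;L(Y,X))`. -/
def historyOp {X Y : Type*} [NormedAddCommGroup X] [NormedSpace ℝ X]
    [NormedAddCommGroup Y] [NormedSpace ℝ Y] {T : ℝ}
    (B : sobolevW1 1 T (Y →L[ℝ] X)) (y₀ : X) (y : ℝ → Y) (t : ℝ) : X :=
  (∫ s in (0 : ℝ)..t, (B.1.fst (t - s)) (y s)) + y₀

/-- The total dissipation `∫₀ᵀ R(H(y)(t), v̇(t)) dt ∈ [0,∞]`. -/
def totalDissipation {X Y : Type*} [NormedAddCommGroup X] [NormedSpace ℝ X]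
    [NormedAddCommGroup Y] [NormedSpace ℝ Y] {T : ℝ} (R : X → Y → ℝ≥0∞)
    (B : sobolevW1 1 T (Y →L[ℝ] X)) (y₀ : X) (y v : sobolevH10 T Y) : ℝ≥0∞ :=
  ∫⁻ t, R (historyOp B y₀ (h10Val y) t) (h10Rate v t) ∂(timeMeasure T)

/-- The set of all `y ∈ H^1_0(0,T;Y)` with `ẏ(t) ∈ D` for almost all `t ∈ (0,T)`. -/
def admissible {Y : Type*} [NormedAddCommGroup Y] [NormedSpace ℝ Y] (T : ℝ) (D : Set Y) :
    Set (sobolevH10 T Y) :=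
  {y | ∀ᵐ t ∂(timeMeasure T), h10Rate y t ∈ D}

/-- The convergence assumption on the dissipation: the domain `D` is closed and, for every sequence
`y m ⇀ y` (weakly in `H^1_0(0,T;Y)`) of admissible functions, a liminf inequality holds and every
admissible `v` has an admissible recovery sequence. -/
structure ConvergenceAssumption {X Y : Type*} [NormedAddCommGroup X] [NormedSpace ℝ X]
    [NormedAddCommGroup Y] [NormedSpace ℝ Y] {T : ℝ} (R : X → Y → ℝ≥0∞) (D : Set Y)
    (B : sobolevW1 1 T (Y →L[ℝ] X)) (y₀ : X) : Prop where
  isClosed_domain : IsClosed D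
  liminf_le : ∀ (y : ℕ → sobolevH10 T Y) (y' : sobolevH10 T Y),
    (∀ m, y m ∈ admissible T D) →
    Tendsto (fun m => toWeakSpace ℝ (sobolevH10 T Y) (y m)) atTop
      (𝓝 (toWeakSpace ℝ (sobolevH10 T Y) y')) →
    totalDissipation R B y₀ y' y'
      ≤ liminf (fun m => totalDissipation R B y₀ (y m) (y m)) atTop
  recovery : ∀ (y : ℕ → sobolevH10 T Y) (y' : sobolevH10 T Y),
    (∀ m, y m ∈ admissible T D) →
    Tendsto (fun m => toWeakSpace ℝ (sobolevH10 T Y) (y m)) atTop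
      (𝓝 (toWeakSpace ℝ (sobolevH10 T Y) y')) →
    ∀ v ∈ admissible T D, ∃ w : ℕ → sobolevH10 T Y,
      (∀ m, w m ∈ admissible T D) ∧ Tendsto w atTop (𝓝 v) ∧
      limsup (fun m => totalDissipation R B y₀ (y m) (w m)) atTop
        ≤ totalDissipation R B y₀ y' v

/-- The loads `ℓ ∈ C([0,T];Y*)` that satisfy the compatibility condition `ℓ(0) ∈ ∂₂R(y₀,0)`. -/
def compatibleLoads {X Y : Type*} [NormedAddCommGroup Y] [NormedSpace ℝ Y]
    (T : ℝ) (R : X → Y → ℝ≥0∞) (y₀ : X) : Set (ℝ → StrongDual ℝ Y) :=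
  {l | ContinuousOn l (Set.Icc 0 T) ∧ l 0 ∈ subdiffTwo R y₀ 0}

end

/-!
Existence of a solution is proved by time discretisation and weak compactness.

With step size `τ`, the increment `d` over `(kτ, (k+1)τ]` solves the stationary inclusion
`ℓ((k+1)τ) - A (q(kτ) + d) ∈ ∂₂R(H(q)(kτ), d)`, explicit in the history and implicit in the state
(`exists_resolvent`, `exists_scheme`). Testing the inclusion at the previous time with the current
increment, and using positive homogeneity and the mixed Lipschitz estimate of `R`, gives
`α ‖d‖ ≤ ‖ℓ((k+1)τ) - ℓ(kτ)‖ + L ‖H(q)(kτ) - H(q)((k-1)τ)‖`, where the compatibility condition plays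
the role of the inclusion at time `0` (`norm_increment_le`). The history is Lipschitz in time with a
constant that involves only the `L¹` norm of `q̇` up to that time (`norm_historyOp_sub_le`), so a
discrete Gronwall argument bounds the piecewise affine interpolants in `H¹(0,T;Y)`. They satisfy the
inclusion at almost every time up to an error that vanishes with `τ`
(`exists_approximate_solution`).

A weakly convergent subsequence exists without any separability (`exists_subseq_tendsto_inner`). The
dissipation passes to the limit by the convergence assumption, and the quadratic term by
`∫₀ᵀ (A q, q̇) ≥ 0` (`inner_primitiveL_nonneg`), which makes it weakly lower semicontinuous. The limit
satisfies the variational inequality integrated over `(0,T)` (`exists_solution_integrated`).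

As `Y` need not be separable, the pointwise inclusion cannot be obtained from countably many test
vectors. Instead a single test function is used: `v̇(t) = (id + ∂₂R(H(q)(t), ·))⁻¹ (λ(t) + q̇(t))`
with `λ = ℓ - A q`. It is measurable since the mixed Lipschitz estimate makes the proximal map
continuous, and the integrated inequality then yields `∫₀ᵀ ‖q̇ - v̇‖² ≤ 0`. Hence `q̇ = v̇`, which is
the inclusion `λ(t) ∈ ∂₂R(H(q)(t), q̇(t))` (`subgradient_of_integrated`).
-/


/-! ### Primitives and integration by parts -/

section primitive

variable {E : Type*} [NormedAddCommGroup E] [NormedSpace ℝ E]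

/-- The primitive `t ↦ ∫_{(-∞, t]} r dμ`. For `μ = timeMeasure T` it vanishes for `t ≤ 0`, is
constant for `t ≥ T`, and equals `∫₀ᵗ r` for `t ∈ [0, T]`. -/
noncomputable def primitive (μ : Measure ℝ) (r : ℝ → E) (t : ℝ) : E := ∫ s in Set.Iic t, r s ∂μ

theorem primitive_congr {μ : Measure ℝ} {r r' : ℝ → E} (h : r =ᵐ[μ] r') :
    primitive μ r = primitive μ r' := by
  funext t
  exact integral_congr_ae (ae_restrict_of_ae h)

theorem primitive_sub_primitive {μ : Measure ℝ} {r : ℝ → E} (hr : Integrable r μ) {s t : ℝ}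
    (hst : s ≤ t) : primitive μ r t - primitive μ r s = ∫ u in Set.Ioc s t, r u ∂μ := by
  rw [sub_eq_iff_eq_add', primitive, primitive, ← setIntegral_union _ measurableSet_Ioc
    hr.integrableOn hr.integrableOn, Set.Iic_union_Ioc_eq_Iic hst]
  exact Set.Iic_disjoint_Ioc le_rfl

theorem continuous_primitive {μ : Measure ℝ} [NullSingletonClass μ] {r : ℝ → E} (hr : Integrable r μ) :
    Continuous (primitive μ r) := by
  have h : primitive μ r = fun t => (∫ u in (0 : ℝ)..t, r u ∂μ) + primitive μ r 0 := by
    funext t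
    rw [← intervalIntegral.integral_Iic_sub_Iic hr.integrableOn hr.integrableOn]
    simp [primitive]
  rw [h]
  exact (intervalIntegral.continuous_primitive (fun a b => hr.intervalIntegrable) 0).add
    continuous_const

theorem norm_primitive_le {μ : Measure ℝ} {r : ℝ → E} (hr : Integrable r μ) (t : ℝ) :
    ‖primitive μ r t‖ ≤ ∫ s, ‖r s‖ ∂μ :=
  (norm_integral_le_integral_norm _).trans
    (setIntegral_le_integral hr.norm (Eventually.of_forall fun _ => norm_nonneg _))

theorem timeMeasure_restrict_Iic {T t : ℝ} (ht : t ∈ Set.Icc 0 T) :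
    (timeMeasure T).restrict (Set.Iic t) = volume.restrict (Set.Ioc 0 t) := by
  rw [Measure.restrict_restrict measurableSet_Iic]
  have h1 : (Set.Iic t ∩ Set.Ioo 0 T : Set ℝ) =ᵐ[volume] Set.Ioc 0 t := by
    have h2 : (Set.Iic t ∩ Set.Ioo 0 T : Set ℝ) =ᵐ[volume] (Set.Iic t ∩ Set.Ioc 0 T : Set ℝ) :=
      (ae_eq_refl _).inter Ioo_ae_eq_Ioc
    have h3 : (Set.Iic t ∩ Set.Ioc 0 T : Set ℝ) = Set.Ioc 0 t := by
      ext s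
      simp only [Set.mem_inter_iff, Set.mem_Iic, Set.mem_Ioc]
      constructor
      · rintro ⟨a, b, c⟩; exact ⟨b, a⟩
      · rintro ⟨a, b⟩; exact ⟨b, a, b.trans ht.2⟩
    rwa [h3] at h2
  exact Measure.restrict_congr_set h1

theorem primitive_timeMeasure {T t : ℝ} (ht : t ∈ Set.Icc 0 T) (r : ℝ → E) :
    primitive (timeMeasure T) r t = ∫ s in (0 : ℝ)..t, r s := by
  rw [primitive, timeMeasure_restrict_Iic ht, intervalIntegral.integral_of_le ht.1]

theorem primitive_timeMeasure_of_nonpos {T t : ℝ} (ht : t ≤ 0) (r : ℝ → E) :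
    primitive (timeMeasure T) r t = 0 := by
  rw [primitive, Measure.restrict_restrict measurableSet_Iic]
  have : (Set.Iic t ∩ Set.Ioo 0 T : Set ℝ) = ∅ := by
    ext s
    simp only [Set.mem_inter_iff, Set.mem_Iic, Set.mem_Ioo, Set.mem_empty_iff_false, iff_false]
    rintro ⟨a, b, c⟩; linarith
  rw [this, Measure.restrict_empty, integral_zero_measure]

/-- Integration by parts for a bilinear map: Fubini on the two triangles `s ≤ t` and `t < s`. -/
theorem integral_bilin_primitive_add {F G : Type*} [CompleteSpace E]
    [NormedAddCommGroup F] [NormedSpace ℝ F] [CompleteSpace F]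
    [NormedAddCommGroup G] [NormedSpace ℝ G] [CompleteSpace G]
    (L : E →L[ℝ] F →L[ℝ] G) {μ : Measure ℝ} [SFinite μ] [NullSingletonClass μ] {f : ℝ → E} {g : ℝ → F}
    (hf : Integrable f μ) (hg : Integrable g μ) :
    ∫ t, L (primitive μ f t) (g t) ∂μ + ∫ t, L (f t) (primitive μ g t) ∂μ
      = L (∫ t, f t ∂μ) (∫ t, g t ∂μ) := by
  have hK : Integrable (fun z : ℝ × ℝ => L (f z.1) (g z.2)) (μ.prod μ) :=
    hf.op_fst_snd (by fun_prop) ⟨‖L‖, L.le_opNorm₂⟩ hg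
  have hS : MeasurableSet {z : ℝ × ℝ | z.1 ≤ z.2} := measurableSet_le measurable_fst measurable_snd
  have h1 : ∫ t, L (primitive μ f t) (g t) ∂μ
      = ∫ z in {z : ℝ × ℝ | z.1 ≤ z.2}, L (f z.1) (g z.2) ∂(μ.prod μ) := by
    rw [← integral_indicator hS, integral_prod_symm _ (hK.indicator hS)]
    refine integral_congr_ae (Eventually.of_forall fun t => ?_)
    change L.flip (g t) (primitive μ f t) = _
    rw [primitive, ← ContinuousLinearMap.integral_comp_comm _ hf.integrableOn,
      ← integral_indicator measurableSet_Iic]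
    rfl
  have h2 : ∫ t, L (f t) (primitive μ g t) ∂μ
      = ∫ z in {z : ℝ × ℝ | z.1 ≤ z.2}ᶜ, L (f z.1) (g z.2) ∂(μ.prod μ) := by
    rw [← integral_indicator hS.compl, integral_prod _ (hK.indicator hS.compl)]
    refine integral_congr_ae (Eventually.of_forall fun t => ?_)
    change L (f t) (primitive μ g t) = _
    rw [primitive, ← Measure.restrict_congr_set Iio_ae_eq_Iic,
      ← ContinuousLinearMap.integral_comp_comm _ hg.integrableOn,
      ← integral_indicator measurableSet_Iio]
    refine integral_congr_ae (Eventually.of_forall fun s => ?_)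
    simp only [Set.indicator, Set.mem_Iio, Set.mem_compl_iff, Set.mem_ofPred_eq, not_le]
  rw [h1, h2, integral_add_compl hS hK, integral_prod_bilin L hf hg]

end primitive

/-! ### Weak derivatives -/

section weakDerivative

variable {E : Type*} [NormedAddCommGroup E] [NormedSpace ℝ E]

theorem primitive_deriv_of_tsupport_subset {T : ℝ} {φ : ℝ → ℝ} (hφ : ContDiff ℝ ∞ φ)
    (hs : tsupport φ ⊆ Set.Ioo 0 T) {t : ℝ} (ht : t ∈ Set.Icc 0 T) :
    primitive (timeMeasure T) (deriv φ) t = φ t := by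
  rw [primitive_timeMeasure ht, intervalIntegral.integral_deriv_eq_sub
    (fun x _ => (hφ.differentiable (by simp)).differentiableAt)
    ((hφ.continuous_deriv (by simp)).intervalIntegrable _ _)]
  have : φ 0 = 0 := image_eq_zero_of_notMem_tsupport fun h => by simpa using hs h
  rw [this, sub_zero]

theorem integrable_of_hasCompactSupport {T : ℝ} {φ : ℝ → ℝ} (hφ : Continuous φ)
    (hc : HasCompactSupport φ) : Integrable φ (timeMeasure T) :=
  (hφ.integrable_of_hasCompactSupport hc).restrict

theorem hasWeakDeriv_primitive [CompleteSpace E] {T : ℝ} (hT : 0 < T) {v : ℝ → E}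
    (hv : Integrable v (timeMeasure T)) : HasWeakDeriv T (primitive (timeMeasure T) v) v := by
  intro φ hφ hc hs
  have hd : Integrable (deriv φ) (timeMeasure T) :=
    integrable_of_hasCompactSupport (hφ.continuous_deriv (by simp)) hc.deriv
  have h := integral_bilin_primitive_add (ContinuousLinearMap.lsmul ℝ ℝ : ℝ →L[ℝ] E →L[ℝ] E) hd hv
  have h0 : ∫ t, deriv φ t ∂(timeMeasure T) = 0 := by
    have h1 := primitive_deriv_of_tsupport_subset hφ hs (Set.right_mem_Icc.2 hT.le)
    have h2 : φ T = 0 := image_eq_zero_of_notMem_tsupport fun h => by simpa using hs h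
    rw [h2, primitive, Measure.restrict_eq_self_of_ae_mem] at h1
    · exact h1
    · filter_upwards [ae_restrict_mem measurableSet_Ioo] with t ht using ht.2.le
  rw [h0] at h
  simp only [map_zero, zero_apply, ContinuousLinearMap.lsmul_apply] at h
  rw [eq_neg_iff_add_eq_zero, add_comm, ← h]
  congr 1
  refine integral_congr_ae ?_
  filter_upwards [ae_restrict_mem measurableSet_Ioo] with t ht
  rw [primitive_deriv_of_tsupport_subset hφ hs (Set.Ioo_subset_Icc_self ht)]

/-- A smooth function with vanishing integral and compact support in `(0,T)` is the derivative of
such a function. -/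
theorem exists_testFunction_deriv_eq {T : ℝ} {h : ℝ → ℝ} (hh : ContDiff ℝ ∞ h)
    (hc : HasCompactSupport h) (hs : tsupport h ⊆ Set.Ioo 0 T) (h0 : ∫ t, h t = 0) :
    ∃ φ : ℝ → ℝ, ContDiff ℝ ∞ φ ∧ HasCompactSupport φ ∧ tsupport φ ⊆ Set.Ioo 0 T ∧
      deriv φ = h := by
  rcases (tsupport h).eq_empty_or_nonempty with he | hne
  · refine ⟨0, contDiff_const, HasCompactSupport.zero, by simp [tsupport], ?_⟩
    rw [tsupport_eq_empty_iff] at he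
    rw [he]; funext t; simp
  obtain ⟨a, ha, hla⟩ := hc.isCompact.exists_isLeast hne
  obtain ⟨b, hb, hlb⟩ := hc.isCompact.exists_isGreatest hne
  have hint : Integrable h := hh.continuous.integrable_of_hasCompactSupport hc
  have hzero : ∀ t, t ∉ Set.Icc a b → h t = 0 := fun t ht =>
    image_eq_zero_of_notMem_tsupport fun hm => ht ⟨hla hm, hlb hm⟩
  set φ : ℝ → ℝ := fun t => ∫ s in a..t, h s with hφ
  have hder : ∀ t, HasDerivAt φ (h t) t := fun t =>
    intervalIntegral.integral_hasDerivAt_right (hh.continuous.intervalIntegrable _ _)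
      (hh.continuous.stronglyMeasurableAtFilter _ _) hh.continuous.continuousAt
  have hd : deriv φ = h := funext fun t => (hder t).deriv
  have hab : a ≤ b := hla hb
  have hout : ∀ t, t ∉ Set.Icc a b → φ t = 0 := by
    intro t ht
    rcases lt_or_ge t a with h1 | h1
    · simp only [hφ]
      rw [intervalIntegral.integral_symm, intervalIntegral.integral_of_le h1.le, neg_eq_zero,
        integral_Ioc_eq_integral_Ioo]
      refine setIntegral_eq_zero_of_forall_eq_zero fun s hs => hzero s fun h2 => ?_
      exact absurd hs.2 (not_lt.2 h2.1)
    · have h2 : b < t := by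
        by_contra h3
        exact ht ⟨h1, not_lt.1 h3⟩
      simp only [hφ]
      rw [intervalIntegral.integral_of_le h1, integral_Ioc_eq_integral_Ioo,
        ← integral_Icc_eq_integral_Ioo, setIntegral_eq_integral_of_forall_compl_eq_zero, h0]
      exact fun s hs => hzero s fun h3 => hs ⟨h3.1, h3.2.trans h2.le⟩
  have hts : tsupport φ ⊆ Set.Icc a b :=
    closure_minimal (fun t ht => by
      by_contra h1
      exact ht (hout t h1)) isClosed_Icc
  refine ⟨φ, ?_, HasCompactSupport.of_support_subset_isCompact isCompact_Icc
    ((subset_tsupport φ).trans hts), hts.trans fun t ht => ⟨(hs ha).1.trans_le ht.1,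
      ht.2.trans_lt (hs hb).2⟩, hd⟩
  rw [contDiff_infty_iff_deriv]
  exact ⟨fun t => (hder t).differentiableAt, hd ▸ hh⟩

theorem integral_smul_timeMeasure {T : ℝ} {g : ℝ → ℝ} (hs : tsupport g ⊆ Set.Ioo 0 T)
    (w : ℝ → E) : ∫ t, g t • w t ∂(timeMeasure T) = ∫ t, g t • w t := by
  refine setIntegral_eq_integral_of_forall_compl_eq_zero fun t ht => ?_
  rw [image_eq_zero_of_notMem_tsupport fun h => ht (hs h), zero_smul]

/-- **Du Bois-Reymond lemma**: a function with vanishing weak derivative is constant. -/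
theorem ae_eq_const_of_integral_deriv_smul_eq_zero [CompleteSpace E] {T : ℝ} (hT : 0 < T)
    {w : ℝ → E} (hw : Integrable w (timeMeasure T))
    (h : ∀ φ : ℝ → ℝ, ContDiff ℝ ∞ φ → HasCompactSupport φ → tsupport φ ⊆ Set.Ioo 0 T →
      ∫ t, deriv φ t • w t ∂(timeMeasure T) = 0) :
    ∃ c : E, w =ᵐ[timeMeasure T] fun _ => c := by
  have hT4 : 0 < T / 4 := by positivity
  let b : ContDiffBump (T / 2 : ℝ) := ⟨T / 8, T / 4, by linarith, by linarith⟩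
  set ψ : ℝ → ℝ := b.normed volume with hψ
  have hψd : ContDiff ℝ ∞ ψ := b.contDiff_normed
  have hψc : HasCompactSupport ψ := b.hasCompactSupport_normed
  have hψs : tsupport ψ ⊆ Set.Ioo 0 T := by
    rw [hψ, b.tsupport_normed_eq, Real.closedBall_eq_Icc]
    intro t ht
    have h1 : b.rOut = T / 4 := rfl
    rw [h1] at ht
    exact ⟨by linarith [ht.1], by linarith [ht.2]⟩
  have hψ1 : ∫ t, ψ t = 1 := b.integral_normed
  set c : E := ∫ t, ψ t • w t ∂(timeMeasure T) with hcdef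
  refine ⟨c, ?_⟩
  have key : ∀ᵐ t ∂(volume : Measure ℝ), t ∈ Set.Ioo 0 T → w t - c = 0 := by
    refine isOpen_Ioo.ae_eq_zero_of_integral_contDiff_smul_eq_zero
      (f := fun t => w t - c) ?_ ?_
    · have hi : IntegrableOn (fun t => w t - c) (Set.Ioo 0 T) := hw.sub (integrable_const c)
      exact hi.locallyIntegrableOn
    intro g hg hgc hgs
    have hgi : Integrable g := hg.continuous.integrable_of_hasCompactSupport hgc
    have hψi : Integrable ψ := hψd.continuous.integrable_of_hasCompactSupport hψc
    set m : ℝ := ∫ t, g t with hm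
    have hsm : HasCompactSupport (fun t => m * ψ t) := hψc.mul_left
    have hsub : tsupport (fun t => g t - m * ψ t) ⊆ Set.Ioo 0 T := by
      refine (tsupport_sub g (fun t => m * ψ t)).trans (Set.union_subset hgs ?_)
      exact (closure_mono (Function.support_mul_subset_right _ _)).trans hψs
    obtain ⟨φ, h1, h2, h3, h4⟩ := exists_testFunction_deriv_eq (T := T)
      (h := fun t => g t - m * ψ t) (hg.sub (contDiff_const.mul hψd))
      (hgc.sub hsm) hsub (by
        rw [integral_sub hgi (hψi.const_mul m), integral_const_mul, hψ1, mul_one, sub_self])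
    have h5 := h φ h1 h2 h3
    rw [h4] at h5
    have bnd : ∀ f : ℝ → ℝ, Continuous f → HasCompactSupport f →
        Integrable (fun t => f t • w t) (timeMeasure T) := by
      intro f hf hfc
      obtain ⟨C, hC⟩ := hfc.exists_bound_of_continuous hf
      exact hw.bdd_smul C hf.aestronglyMeasurable (Eventually.of_forall hC)
    have h6 : ∫ t, g t • w t ∂(timeMeasure T) = m • c := by
      simp only [sub_smul, mul_smul] at h5
      rw [integral_sub (bnd g hg.continuous hgc) ((bnd ψ hψd.continuous hψc).fun_smul m),
        integral_smul, sub_eq_zero] at h5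
      exact h5
    have h7 : ∫ t, g t • c ∂(timeMeasure T) = m • c := by
      rw [integral_smul_timeMeasure hgs, integral_smul_const]
    rw [← integral_smul_timeMeasure hgs]
    simp only [smul_sub]
    rw [integral_sub (bnd g hg.continuous hgc) (hgi.restrict.smul_const c), h6, h7, sub_self]
  rw [Filter.EventuallyEq, ae_restrict_iff' measurableSet_Ioo]
  filter_upwards [key] with t ht h using sub_eq_zero.1 (ht h)

/-- A function with an integrable weak derivative is, up to a constant, the primitive of it. -/
theorem HasWeakDeriv.ae_eq_const_add_primitive [CompleteSpace E] {T : ℝ} (hT : 0 < T)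
    {u v : ℝ → E} (hu : Integrable u (timeMeasure T)) (hv : Integrable v (timeMeasure T))
    (h : HasWeakDeriv T u v) :
    ∃ c : E, u =ᵐ[timeMeasure T] fun t => c + primitive (timeMeasure T) v t := by
  have hp : Integrable (primitive (timeMeasure T) v) (timeMeasure T) := by
    refine Integrable.of_bound (continuous_primitive hv).aestronglyMeasurable _
      (Eventually.of_forall (norm_primitive_le hv))
  obtain ⟨c, hc⟩ := ae_eq_const_of_integral_deriv_smul_eq_zero hT (hu.sub hp) (by
    intro φ hφ hcs hs
    have hd := hφ.continuous_deriv (by simp)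
    obtain ⟨C, hC⟩ := hcs.deriv.exists_bound_of_continuous hd
    have bnd : ∀ w : ℝ → E, Integrable w (timeMeasure T) →
        Integrable (fun t => deriv φ t • w t) (timeMeasure T) := fun w hw =>
      hw.bdd_smul C hd.aestronglyMeasurable (Eventually.of_forall hC)
    simp only [Pi.sub_apply, smul_sub]
    rw [integral_sub (bnd u hu) (bnd _ hp), h φ hφ hcs hs, hasWeakDeriv_primitive hT hv φ hφ hcs hs,
      sub_self])
  refine ⟨c, ?_⟩
  filter_upwards [hc] with t ht
  rw [← ht, Pi.sub_apply, sub_add_cancel]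

end weakDerivative

/-! ### Resolvents of convex functionals -/

section resolvent

variable {Y : Type*} [NormedAddCommGroup Y] [InnerProductSpace ℝ Y]

theorem convexComb_toReal_le {ψ : Y → ℝ≥0∞}
    (hconv : ∀ η₁ η₂ : Y, ∀ a b : ℝ≥0, a + b = 1 → ψ (a • η₁ + b • η₂) ≤ a * ψ η₁ + b * ψ η₂)
    {x y : Y} (hx : ψ x ≠ ⊤) (hy : ψ y ≠ ⊤) {s : ℝ} (hs : s ∈ Set.Icc (0 : ℝ) 1) :
    ψ ((1 - s) • x + s • y) ≠ ⊤ ∧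
      (ψ ((1 - s) • x + s • y)).toReal ≤ (1 - s) * (ψ x).toReal + s * (ψ y).toReal := by
  have h1s : 0 ≤ 1 - s := by linarith [hs.2]
  obtain ⟨a, ha⟩ : ∃ a : ℝ≥0, (a : ℝ) = 1 - s := ⟨⟨1 - s, h1s⟩, rfl⟩
  obtain ⟨b, hb⟩ : ∃ b : ℝ≥0, (b : ℝ) = s := ⟨⟨s, hs.1⟩, rfl⟩
  have h := hconv x y a b (by rw [← NNReal.coe_inj, NNReal.coe_add, ha, hb]; simp)
  have hfin : (a : ℝ≥0∞) * ψ x + (b : ℝ≥0∞) * ψ y ≠ ⊤ :=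
    ENNReal.add_ne_top.2 ⟨ENNReal.mul_ne_top ENNReal.coe_ne_top hx,
      ENNReal.mul_ne_top ENNReal.coe_ne_top hy⟩
  rw [NNReal.smul_def, NNReal.smul_def, ha, hb] at h
  refine ⟨ne_top_of_le_ne_top hfin h, ?_⟩
  have h2 := ENNReal.toReal_mono hfin h
  rw [ENNReal.toReal_add (ENNReal.mul_ne_top ENNReal.coe_ne_top hx)
    (ENNReal.mul_ne_top ENNReal.coe_ne_top hy), ENNReal.toReal_mul, ENNReal.toReal_mul,
    ENNReal.coe_toReal, ENNReal.coe_toReal, ha, hb] at h2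
  exact h2

variable [CompleteSpace Y]

/-- The inclusion `f - A η ∈ ∂ψ(η)` has a solution: `η` minimises the strongly convex functional
`½ (A η, η) - f η + ψ η`, and minimising sequences of it are Cauchy. -/
theorem exists_resolvent {A : Y →L[ℝ] Y} (hA : IsSelfAdjoint A) {α : ℝ} (hα : 0 < α)
    (hcoer : ∀ y : Y, α * ‖y‖ ^ 2 ≤ inner ℝ (A y) y) {ψ : Y → ℝ≥0∞}
    (hconv : ∀ η₁ η₂ : Y, ∀ a b : ℝ≥0, a + b = 1 → ψ (a • η₁ + b • η₂) ≤ a * ψ η₁ + b * ψ η₂)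
    (hlsc : LowerSemicontinuous ψ) (hprop : ∃ η, ψ η ≠ ⊤) (f : StrongDual ℝ Y) :
    ∃ η, ψ η ≠ ⊤ ∧ ∀ v, ψ v ≠ ⊤ →
      (ψ η).toReal + (f (v - η) - inner ℝ (A η) (v - η)) ≤ (ψ v).toReal := by
  have hsymm : ∀ x y : Y, inner ℝ (A x) y = inner ℝ (A y) x := fun x y => by
    rw [real_inner_comm]; exact (hA.isSymmetric y x).symm
  set Q : Y → ℝ := fun x => (1 / 2) * inner ℝ (A x) x - f x with hQ
  have hQc : Continuous Q := by fun_prop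
  have hexp : ∀ (x v : Y) (s : ℝ), Q ((1 - s) • x + s • v)
      = Q x + s * (inner ℝ (A x) (v - x) - f (v - x))
        + s ^ 2 / 2 * inner ℝ (A (v - x)) (v - x) := by
    intro x v s
    have h1 := hsymm v x
    simp only [hQ, map_add, map_sub, map_smul, inner_add_left, inner_add_right, inner_sub_left,
      inner_sub_right, inner_smul_left, inner_smul_right, smul_eq_mul, RCLike.conj_to_real, h1]
    ring
  set J : Y → ℝ := fun x => Q x + (ψ x).toReal with hJ
  have hbdd : BddBelow (J '' {x | ψ x ≠ ⊤}) := by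
    refine ⟨-(‖f‖ ^ 2 / (2 * α)), ?_⟩
    rintro _ ⟨x, -, rfl⟩
    have h1 : f x ≤ ‖f‖ * ‖x‖ := (le_abs_self _).trans (f.le_opNorm x)
    have h2 := hcoer x
    have h3 : (0 : ℝ) ≤ (ψ x).toReal := ENNReal.toReal_nonneg
    have h4 : ‖f‖ * ‖x‖ ≤ α / 2 * ‖x‖ ^ 2 + ‖f‖ ^ 2 / (2 * α) := by
      have h5 : α / 2 * ‖x‖ ^ 2 + ‖f‖ ^ 2 / (2 * α) - ‖f‖ * ‖x‖
          = (α * ‖x‖ - ‖f‖) ^ 2 / (2 * α) := by field_simp; ring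
      have h6 : 0 ≤ (α * ‖x‖ - ‖f‖) ^ 2 / (2 * α) := by positivity
      linarith
    simp only [hJ, hQ]
    linarith
  have hne : (J '' {x | ψ x ≠ ⊤}).Nonempty := by
    obtain ⟨η, hη⟩ := hprop
    exact ⟨J η, η, hη, rfl⟩
  set m : ℝ := sInf (J '' {x | ψ x ≠ ⊤}) with hm
  have hmle : ∀ x, ψ x ≠ ⊤ → m ≤ J x := fun x hx => csInf_le hbdd ⟨x, hx, rfl⟩
  have hseq : ∀ n : ℕ, ∃ x, ψ x ≠ ⊤ ∧ J x < m + 1 / ((n : ℝ) + 1) := by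
    intro n
    obtain ⟨_, ⟨x, hx, rfl⟩, hlt⟩ := exists_lt_of_csInf_lt hne
      (lt_add_of_pos_right m (by positivity : (0 : ℝ) < 1 / ((n : ℝ) + 1)))
    exact ⟨x, hx, hlt⟩
  choose x hx hxm using hseq
  have hgap : ∀ u v : Y, ψ u ≠ ⊤ → ψ v ≠ ⊤ →
      α / 8 * ‖u - v‖ ^ 2 ≤ (J u + J v) / 2 - m := by
    intro u v hu hv
    obtain ⟨h1, h2⟩ := convexComb_toReal_le hconv hu hv
      (s := 1 / 2) ⟨by norm_num, by norm_num⟩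
    have h3 := hmle _ h1
    have h4 := hexp u v (1 / 2)
    have h5 := hexp u v 1
    have h6 := hcoer (v - u)
    simp only [sub_self, zero_smul, zero_add, one_smul] at h5
    rw [norm_sub_rev]
    simp only [hJ] at h3 ⊢
    linarith
  have hlim0 : Tendsto (fun n : ℕ => 1 / ((n : ℝ) + 1)) atTop (𝓝 0) :=
    tendsto_one_div_add_atTop_nhds_zero_nat
  have hcauchy : CauchySeq x := by
    rw [Metric.cauchySeq_iff]
    intro ε hε
    have h1 : ∀ᶠ n : ℕ in atTop, 1 / ((n : ℝ) + 1) < α / 8 * ε ^ 2 :=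
      hlim0.eventually_lt_const (by positivity)
    obtain ⟨N, hN⟩ := eventually_atTop.1 h1
    refine ⟨N, fun i hi j hj => ?_⟩
    have h2 := hgap (x i) (x j) (hx i) (hx j)
    have h3 := hN i hi
    have h4 := hN j hj
    have h5 : α / 8 * ‖x i - x j‖ ^ 2 < α / 8 * ε ^ 2 := by
      linarith [hxm i, hxm j]
    rw [dist_eq_norm]
    exact lt_of_pow_lt_pow_left₀ 2 hε.le (lt_of_mul_lt_mul_left h5 (by positivity))
  obtain ⟨η, hη⟩ := cauchySeq_tendsto_of_complete hcauchy
  have hval : ψ η ≤ ENNReal.ofReal (m - Q η) := by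
    refine le_of_forall_lt fun c hc => ?_
    obtain ⟨c', hcc', hc'⟩ := exists_between hc
    have h1 : ∀ᶠ n in atTop, c' < ψ (x n) := hη.eventually (hlsc η c' hc')
    have h2 : Tendsto (fun n : ℕ => ENNReal.ofReal (m + 1 / ((n : ℝ) + 1) - Q (x n))) atTop
        (𝓝 (ENNReal.ofReal (m + 0 - Q η))) :=
      ENNReal.tendsto_ofReal ((hlim0.const_add m).sub ((hQc.tendsto η).comp hη))
    rw [add_zero] at h2
    refine hcc'.trans_le (ge_of_tendsto h2 ?_)
    filter_upwards [h1] with n hn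
    refine hn.le.trans ?_
    rw [← ENNReal.ofReal_toReal (hx n)]
    have h3 := hxm n
    simp only [hJ] at h3
    exact ENNReal.ofReal_le_ofReal (by linarith)
  have hηfin : ψ η ≠ ⊤ := ne_top_of_le_ne_top ENNReal.ofReal_ne_top hval
  have hmin : J η ≤ m := by
    have h1 := ENNReal.toReal_mono ENNReal.ofReal_ne_top hval
    rw [ENNReal.toReal_ofReal'] at h1
    have h2 : 0 ≤ m - Q η := by
      have h3 : Tendsto (fun n : ℕ => m + 1 / ((n : ℝ) + 1) - Q (x n)) atTop (𝓝 (m + 0 - Q η)) :=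
        (hlim0.const_add m).sub ((hQc.tendsto η).comp hη)
      rw [add_zero] at h3
      refine ge_of_tendsto' h3 fun n => ?_
      have h4 := hxm n
      have h5 : (0 : ℝ) ≤ (ψ (x n)).toReal := ENNReal.toReal_nonneg
      simp only [hJ] at h4
      linarith
    rw [max_eq_left h2] at h1
    simp only [hJ]; linarith
  refine ⟨η, hηfin, fun v hv => ?_⟩
  -- The minimality of `η` on the segment from `η` to `v`, divided by the length parameter `s → 0`.
  have hs : ∀ s ∈ Set.Ioc (0 : ℝ) 1, 0 ≤ (inner ℝ (A η) (v - η) - f (v - η))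
      + ((ψ v).toReal - (ψ η).toReal) + s * (inner ℝ (A (v - η)) (v - η) / 2) := by
    intro s hs
    obtain ⟨h1, h2⟩ := convexComb_toReal_le hconv hηfin hv ⟨hs.1.le, hs.2⟩
    have h3 := hmle _ h1
    have h4 := hexp η v s
    simp only [hJ] at h3 hmin
    have h5 : 0 ≤ s * ((inner ℝ (A η) (v - η) - f (v - η))
      + ((ψ v).toReal - (ψ η).toReal) + s * (inner ℝ (A (v - η)) (v - η) / 2)) := by
      nlinarith
    exact nonneg_of_mul_nonneg_right h5 hs.1
  have hlim : Tendsto (fun s : ℝ => (inner ℝ (A η) (v - η) - f (v - η))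
      + ((ψ v).toReal - (ψ η).toReal) + s * (inner ℝ (A (v - η)) (v - η) / 2)) (𝓝[>] 0)
      (𝓝 ((inner ℝ (A η) (v - η) - f (v - η))
      + ((ψ v).toReal - (ψ η).toReal) + 0 * (inner ℝ (A (v - η)) (v - η) / 2))) := by
    refine Tendsto.mono_left (Continuous.tendsto ?_ 0) nhdsWithin_le_nhds
    fun_prop
  have := ge_of_tendsto hlim (by
    filter_upwards [Ioc_mem_nhdsGT (zero_lt_one' ℝ)] with s h using hs s h)
  linarith

end resolvent

/-! ### Dissipation functionals and their proximal maps -/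

namespace IsDissipation

section basic

variable {X Y : Type*} [NormedAddCommGroup X] [NormedSpace ℝ X]
    [NormedAddCommGroup Y] [NormedSpace ℝ Y] {R : X → Y → ℝ≥0∞} {D : Set Y}

theorem ne_top_iff (hR : IsDissipation R D) {ζ : X} {η : Y} : R ζ η ≠ ⊤ ↔ η ∈ D := by
  rw [← hR.domain_eq ζ, ← lt_top_iff_ne_top]; rfl

theorem apply_zero (hR : IsDissipation R D) (ζ : X) : R ζ 0 = 0 := by
  simpa using hR.posHomogeneous ζ 0 0

theorem zero_mem (hR : IsDissipation R D) : (0 : Y) ∈ D := by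
  rw [← hR.ne_top_iff (ζ := 0), hR.apply_zero]
  exact ENNReal.zero_ne_top

theorem toReal_smul (hR : IsDissipation R D) (ζ : X) {γ : ℝ} (hγ : 0 ≤ γ) (η : Y) :
    (R ζ (γ • η)).toReal = γ * (R ζ η).toReal := by
  have h := hR.posHomogeneous ζ ⟨γ, hγ⟩ η
  have h2 := congrArg ENNReal.toReal h
  rwa [ENNReal.toReal_mul] at h2

theorem smul_mem (hR : IsDissipation R D) {γ : ℝ} (hγ : 0 ≤ γ) {η : Y} (hη : η ∈ D) :
    γ • η ∈ D := by
  rw [← hR.ne_top_iff (ζ := 0)] at hη ⊢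
  have h := hR.posHomogeneous 0 ⟨γ, hγ⟩ η
  have h2 : R 0 (γ • η) = _ := h
  rw [h2]
  exact ENNReal.mul_ne_top ENNReal.coe_ne_top hη

/-- The constant of the mixed Lipschitz estimate bounds the oscillation of `R(·, η)`. -/
theorem toReal_le_add (hR : IsDissipation R D) {L : ℝ} (hL : ∀ ζ₁ ζ₂ : X, ∀ η₁ ∈ D, ∀ η₂ ∈ D,
    (R ζ₁ η₂).toReal - (R ζ₁ η₁).toReal + (R ζ₂ η₁).toReal - (R ζ₂ η₂).toReal
      ≤ L * ‖ζ₁ - ζ₂‖ * ‖η₁ - η₂‖) (ζ₁ ζ₂ : X) {η : Y} (hη : η ∈ D) :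
    (R ζ₁ η).toReal ≤ (R ζ₂ η).toReal + L * ‖ζ₁ - ζ₂‖ * ‖η‖ := by
  have h := hL ζ₁ ζ₂ 0 hR.zero_mem η hη
  simp only [hR.apply_zero, ENNReal.toReal_zero, zero_sub, norm_neg] at h
  linarith

end basic

section prox

variable {X Y : Type*} [NormedAddCommGroup X] [NormedSpace ℝ X]
    [NormedAddCommGroup Y] [InnerProductSpace ℝ Y] [CompleteSpace Y]
    {R : X → Y → ℝ≥0∞} {D : Set Y}

theorem exists_prox (hR : IsDissipation R D) (ζ : X) (f : Y) :
    ∃ η ∈ D, ∀ v ∈ D, (R ζ η).toReal + inner ℝ (f - η) (v - η) ≤ (R ζ v).toReal := by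
  obtain ⟨η, h1, h2⟩ := exists_resolvent (A := ContinuousLinearMap.id ℝ Y)
    (IsSelfAdjoint.one (Y →L[ℝ] Y)) one_pos (fun y => by simp)
    (hR.convex ζ) (hR.lowerSemicontinuous ζ) (hR.proper ζ) (innerSL ℝ f)
  refine ⟨η, hR.ne_top_iff.1 h1, fun v hv => ?_⟩
  have h3 := h2 v (hR.ne_top_iff.2 hv)
  rw [inner_sub_left]
  exact h3

/-- The proximal map of `R(ζ, ·)`, that is, the resolvent `(id + ∂₂R(ζ, ·))⁻¹`. -/
noncomputable def prox (hR : IsDissipation R D) (p : X × Y) : Y :=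
  (hR.exists_prox p.1 p.2).choose

theorem prox_mem (hR : IsDissipation R D) (p : X × Y) : hR.prox p ∈ D :=
  (hR.exists_prox p.1 p.2).choose_spec.1

theorem prox_spec (hR : IsDissipation R D) (p : X × Y) {v : Y} (hv : v ∈ D) :
    (R p.1 (hR.prox p)).toReal + inner ℝ (p.2 - hR.prox p) (v - hR.prox p) ≤ (R p.1 v).toReal :=
  (hR.exists_prox p.1 p.2).choose_spec.2 v hv

theorem norm_prox_le (hR : IsDissipation R D) (p : X × Y) : ‖hR.prox p‖ ≤ ‖p.2‖ := by
  have h := hR.prox_spec p hR.zero_mem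
  rw [hR.apply_zero, ENNReal.toReal_zero, zero_sub, inner_neg_right, inner_sub_left,
    real_inner_self_eq_norm_sq] at h
  have h1 : (0 : ℝ) ≤ (R p.1 (hR.prox p)).toReal := ENNReal.toReal_nonneg
  have h2 := real_inner_le_norm p.2 (hR.prox p)
  rcases (norm_nonneg (hR.prox p)).eq_or_lt with h3 | h3
  · rw [← h3]; exact norm_nonneg _
  · refine le_of_mul_le_mul_right ?_ h3
    nlinarith

/-- The mixed Lipschitz estimate makes the proximal map Lipschitz in both arguments. -/
theorem norm_prox_sub_le (hR : IsDissipation R D) {L : ℝ} (hL0 : 0 ≤ L)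
    (hL : ∀ ζ₁ ζ₂ : X, ∀ η₁ ∈ D, ∀ η₂ ∈ D,
    (R ζ₁ η₂).toReal - (R ζ₁ η₁).toReal + (R ζ₂ η₁).toReal - (R ζ₂ η₂).toReal
      ≤ L * ‖ζ₁ - ζ₂‖ * ‖η₁ - η₂‖) (p p' : X × Y) :
    ‖hR.prox p - hR.prox p'‖ ≤ L * ‖p.1 - p'.1‖ + ‖p.2 - p'.2‖ := by
  have h1 := hR.prox_spec p (hR.prox_mem p')
  have h2 := hR.prox_spec p' (hR.prox_mem p)
  have h3 := hL p.1 p'.1 _ (hR.prox_mem p) _ (hR.prox_mem p')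
  set a := hR.prox p
  set b := hR.prox p'
  have h4 : ‖a - b‖ ^ 2 = inner ℝ (p.2 - p'.2) (a - b)
      + inner ℝ (p.2 - a) (b - a) + inner ℝ (p'.2 - b) (a - b) := by
    rw [← real_inner_self_eq_norm_sq, ← neg_sub a b, inner_neg_right, ← sub_eq_add_neg,
      ← inner_sub_left, ← inner_add_left]
    congr 1; abel
  have h5 := real_inner_le_norm (p.2 - p'.2) (a - b)
  rcases (norm_nonneg (a - b)).eq_or_lt with h6 | h6
  · rw [← h6]; positivity
  · refine le_of_mul_le_mul_right ?_ h6
    nlinarith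

theorem continuous_prox (hR : IsDissipation R D) : Continuous hR.prox := by
  obtain ⟨L, hL0, hL⟩ := hR.mixedLipschitz
  rw [continuous_iff_continuousAt]
  intro p
  rw [ContinuousAt, tendsto_iff_norm_sub_tendsto_zero]
  refine squeeze_zero (fun _ => norm_nonneg _) (fun p' => hR.norm_prox_sub_le hL0 hL p' p) ?_
  have h : Continuous fun p' : X × Y => L * ‖p'.1 - p.1‖ + ‖p'.2 - p.2‖ := by fun_prop
  simpa using h.tendsto p

end prox

end IsDissipation

/-! ### The history operator -/

section history

variable {E : Type*} [NormedAddCommGroup E] [NormedSpace ℝ E]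

theorem integrable_Lp_timeMeasure {E : Type*} [NormedAddCommGroup E] {T : ℝ} {p : ℝ≥0∞} [Fact (1 ≤ p)] (f : Lp E p (timeMeasure T)) :
    Integrable f (timeMeasure T) := (Lp.memLp f).integrable Fact.out

theorem exists_ae_bound_of_mem_sobolevW1 [CompleteSpace E] {T : ℝ} (hT : 0 < T) {p : ℝ≥0∞}
    [Fact (1 ≤ p)] (B : sobolevW1 p T E) :
    ∃ M : ℝ, 0 ≤ M ∧ ∀ᵐ t ∂(timeMeasure T), ‖B.1.fst t‖ ≤ M := by
  have hv := integrable_Lp_timeMeasure B.1.snd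
  obtain ⟨c, hc⟩ := HasWeakDeriv.ae_eq_const_add_primitive hT
    (integrable_Lp_timeMeasure B.1.fst) hv B.2
  refine ⟨‖c‖ + ∫ s, ‖B.1.snd s‖ ∂(timeMeasure T),
    add_nonneg (norm_nonneg _) (integral_nonneg fun _ => norm_nonneg _), ?_⟩
  filter_upwards [hc] with t ht
  rw [ht]
  exact (norm_add_le _ _).trans (add_le_add_right (norm_primitive_le hv t) _)

theorem norm_primitive_sub_le_of_ae_bound {T : ℝ} {f : ℝ → E} (hf : Integrable f (timeMeasure T))
    {M : ℝ} (hM : 0 ≤ M) (hb : ∀ᵐ t ∂(timeMeasure T), ‖f t‖ ≤ M) {s t : ℝ} (hst : s ≤ t) :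
    ‖primitive (timeMeasure T) f t - primitive (timeMeasure T) f s‖ ≤ M * (t - s) := by
  rw [primitive_sub_primitive hf hst]
  have hle : (timeMeasure T) (Set.Ioc s t) ≤ ENNReal.ofReal (t - s) :=
    (Measure.restrict_apply_le _ _).trans_eq Real.volume_Ioc
  refine (norm_setIntegral_le_of_norm_le_const_ae (hle.trans_lt ENNReal.ofReal_lt_top)
    (ae_restrict_of_ae hb)).trans ?_
  refine mul_le_mul_of_nonneg_left ?_ hM
  rw [Measure.real]
  exact ENNReal.toReal_le_of_le_ofReal (sub_nonneg.2 hst) hle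

variable {X Y : Type*} [NormedAddCommGroup X] [NormedSpace ℝ X] [CompleteSpace X]
    [NormedAddCommGroup Y] [NormedSpace ℝ Y] [CompleteSpace Y]

/-- Integration by parts moves the derivative from the kernel to the argument: the history of a
primitive is the convolution of its density with the primitive of the kernel. -/
theorem historyOp_primitive {T : ℝ} (B : sobolevW1 1 T (Y →L[ℝ] X)) (y₀ : X) {r : ℝ → Y}
    (hr : Integrable r (timeMeasure T)) {t : ℝ} (ht : t ∈ Set.Icc 0 T) :
    historyOp B y₀ (primitive (timeMeasure T) r) t
      = (∫ u, primitive (timeMeasure T) B.1.fst (t - u) (r u) ∂(timeMeasure T)) + y₀ := by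
  set β : ℝ → Y →L[ℝ] X := ⇑B.1.fst with hβ
  have hβi : Integrable β (timeMeasure T) := integrable_Lp_timeMeasure B.1.fst
  have hβv : IntervalIntegrable β volume 0 t := by
    rw [intervalIntegrable_iff_integrableOn_Ioo_of_le ht.1]
    exact IntegrableOn.mono_set hβi (Set.Ioo_subset_Ioo_right ht.2)
  have hgv : IntervalIntegrable (fun s => β (t - s)) volume 0 t := by
    simpa using (hβv.comp_sub_left t).symm
  have hg : Integrable (fun s => β (t - s)) (timeMeasure t) := by
    rwa [intervalIntegrable_iff_integrableOn_Ioo_of_le ht.1] at hgv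
  have hrt : Integrable r (timeMeasure t) :=
    IntegrableOn.mono_set hr (Set.Ioo_subset_Ioo_right ht.2)
  have key := integral_bilin_primitive_add (ContinuousLinearMap.apply ℝ X : Y →L[ℝ] _) hrt hg
  rw [historyOp]
  congr 1
  have h1 : ∫ s in (0 : ℝ)..t, (β (t - s)) (primitive (timeMeasure T) r s)
      = ∫ s, (β (t - s)) (primitive (timeMeasure t) r s) ∂(timeMeasure t) := by
    rw [intervalIntegral.integral_of_le ht.1, integral_Ioc_eq_integral_Ioo]
    refine setIntegral_congr_fun measurableSet_Ioo fun s hs => ?_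
    rw [primitive_timeMeasure ⟨hs.1.le, hs.2.le⟩, primitive_timeMeasure ⟨hs.1.le, hs.2.le.trans ht.2⟩]
  have h2 : ∫ u, primitive (timeMeasure T) β (t - u) (r u) ∂(timeMeasure T)
      = ∫ u, primitive (timeMeasure T) β (t - u) (r u) ∂(timeMeasure t) := by
    refine setIntegral_eq_of_subset_of_forall_sdiff_eq_zero measurableSet_Ioo
      (Set.Ioo_subset_Ioo_right ht.2) fun u hu => ?_
    have : t ≤ u := by
      by_contra h
      exact hu.2 ⟨hu.1.1, not_le.1 h⟩
    rw [primitive_timeMeasure_of_nonpos (by linarith)]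
    rfl
  rw [h1, h2]
  simp only [ContinuousLinearMap.apply_apply] at key
  rw [eq_sub_of_add_eq key]
  have h3 : ∀ u ∈ Set.Ioo 0 t, primitive (timeMeasure T) β (t - u)
      = (∫ s, β (t - s) ∂(timeMeasure t)) - primitive (timeMeasure t) (fun s => β (t - s)) u := by
    intro u hu
    rw [primitive_timeMeasure ⟨by linarith [hu.2], by linarith [hu.1, ht.2]⟩,
      primitive_timeMeasure ⟨hu.1.le, hu.2.le⟩, ← integral_Ioc_eq_integral_Ioo,
      ← intervalIntegral.integral_of_le ht.1, intervalIntegral.integral_interval_sub_left hgv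
        (hgv.mono_set (by
          rw [Set.uIcc_of_le hu.1.le, Set.uIcc_of_le ht.1]
          exact Set.Icc_subset_Icc_right hu.2.le)),
      intervalIntegral.integral_comp_sub_left, sub_self]
  have hp : Integrable (fun u => primitive (timeMeasure t) (fun s => β (t - s)) u (r u))
      (timeMeasure t) := by
    refine Integrable.mono' (hrt.norm.const_mul (∫ s, ‖β (t - s)‖ ∂(timeMeasure t)))
      (isBoundedBilinearMap_apply.continuous.comp_aestronglyMeasurable
        ((continuous_primitive hg).aestronglyMeasurable.prodMk hrt.1))
      (Eventually.of_forall fun u => ?_)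
    exact (ContinuousLinearMap.le_opNorm _ _).trans
      (mul_le_mul_of_nonneg_right (norm_primitive_le hg u) (norm_nonneg _))
  rw [← ContinuousLinearMap.integral_comp_comm _ hrt, ← integral_sub
    (ContinuousLinearMap.integrable_comp _ hrt) hp]
  refine setIntegral_congr_fun measurableSet_Ioo fun u hu => ?_
  rw [h3 u hu]
  rfl

/-- The primitive of the kernel is Lipschitz and vanishes at negative times, hence the history is Lipschitz in time with a constant
that sees the density only up to the later of the two times. -/
theorem norm_historyOp_sub_le {T : ℝ} (B : sobolevW1 1 T (Y →L[ℝ] X)) (y₀ : X) {M : ℝ}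
    (hM : 0 ≤ M) (hB : ∀ᵐ t ∂(timeMeasure T), ‖B.1.fst t‖ ≤ M) {r : ℝ → Y}
    (hr : Integrable r (timeMeasure T)) {s t : ℝ} (hs : 0 ≤ s) (hst : s ≤ t) (ht : t ≤ T) :
    ‖historyOp B y₀ (primitive (timeMeasure T) r) t
        - historyOp B y₀ (primitive (timeMeasure T) r) s‖
      ≤ M * (t - s) * primitive (timeMeasure T) (fun u => ‖r u‖) t := by
  have hβi : Integrable B.1.fst (timeMeasure T) := integrable_Lp_timeMeasure B.1.fst
  have hint : ∀ x : ℝ, Integrable (fun u => primitive (timeMeasure T) B.1.fst (x - u) (r u))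
      (timeMeasure T) := by
    intro x
    refine Integrable.mono' (hr.norm.const_mul (∫ s, ‖B.1.fst s‖ ∂(timeMeasure T)))
      (isBoundedBilinearMap_apply.continuous.comp_aestronglyMeasurable
        (((continuous_primitive hβi).comp (by fun_prop : Continuous fun u => x - u)
          ).aestronglyMeasurable.prodMk hr.1))
      (Eventually.of_forall fun u => ?_)
    exact (ContinuousLinearMap.le_opNorm _ _).trans
      (mul_le_mul_of_nonneg_right (norm_primitive_le hβi _) (norm_nonneg _))
  rw [historyOp_primitive B y₀ hr ⟨hs.trans hst, ht⟩, historyOp_primitive B y₀ hr ⟨hs, hst.trans ht⟩,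
    add_sub_add_right_eq_sub, ← integral_sub (hint t) (hint s), primitive,
    ← integral_const_mul, ← integral_indicator measurableSet_Iic]
  refine norm_integral_le_of_norm_le ((hr.norm.const_mul _).indicator measurableSet_Iic)
    (Eventually.of_forall fun u => ?_)
  by_cases hu : u ≤ t
  · rw [Set.indicator_of_mem (Set.mem_Iic.2 hu), ← sub_apply]
    refine (ContinuousLinearMap.le_opNorm _ _).trans
      (mul_le_mul_of_nonneg_right ?_ (norm_nonneg _))
    have := norm_primitive_sub_le_of_ae_bound hβi hM hB (sub_le_sub_right hst u)
    rwa [sub_sub_sub_cancel_right] at this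
  · rw [Set.indicator_of_notMem (by simpa using hu),
      primitive_timeMeasure_of_nonpos (by linarith), primitive_timeMeasure_of_nonpos (by linarith)]
    simp

end history

/-! ### Step functions and causal recursion -/

section stepFunctions

variable {E : Type*} [NormedAddCommGroup E] [NormedSpace ℝ E]

/-- The step function with value `d (k+1) / τ` on `(kτ, (k+1)τ]`: the rate of the piecewise affine
interpolant with increments `d (k+1)`. -/
noncomputable def stepRate (τ : ℝ) (d : ℕ → E) (t : ℝ) : E := τ⁻¹ • d ⌈t / τ⌉₊

theorem natCeil_div_eq {τ : ℝ} (hτ : 0 < τ) {k : ℕ} {t : ℝ}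
    (ht : t ∈ Set.Ioc (k * τ) ((k + 1 : ℕ) * τ)) : ⌈t / τ⌉₊ = k + 1 := by
  rw [Nat.ceil_eq_iff (by simp), lt_div_iff₀ hτ, div_le_iff₀ hτ]
  simpa using ht

theorem stepRate_eq {τ : ℝ} (hτ : 0 < τ) (d : ℕ → E) {k : ℕ} {t : ℝ}
    (ht : t ∈ Set.Ioc (k * τ) ((k + 1 : ℕ) * τ)) : stepRate τ d t = τ⁻¹ • d (k + 1) := by
  rw [stepRate, natCeil_div_eq hτ ht]

theorem stepRate_congr {τ : ℝ} (hτ : 0 < τ) {d d' : ℕ → E} {k : ℕ}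
    (h : ∀ j ≤ k, d j = d' j) {t : ℝ} (ht : t ≤ k * τ) : stepRate τ d t = stepRate τ d' t := by
  rw [stepRate, stepRate, h]
  rw [Nat.ceil_le, div_le_iff₀ hτ]
  exact ht

theorem norm_stepRate {τ : ℝ} (hτ : 0 < τ) (d : ℕ → E) (t : ℝ) :
    ‖stepRate τ d t‖ = stepRate τ (fun k => ‖d k‖) t := by
  rw [stepRate, stepRate, norm_smul, norm_inv, Real.norm_of_nonneg hτ.le, smul_eq_mul]

theorem memLp_stepRate {T τ : ℝ} (hτ : 0 < τ) (d : ℕ → E) :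
    MemLp (stepRate τ d) ⊤ (timeMeasure T) := by
  have hm : AEStronglyMeasurable (stepRate τ d) (timeMeasure T) := by
    have h1 : StronglyMeasurable d := .of_discrete
    exact ((h1.comp_measurable
      (Nat.measurable_ceil.comp (measurable_id.div_const τ))).const_smul τ⁻¹).aestronglyMeasurable
  refine memLp_top_of_bound hm (∑ j ∈ Finset.range (⌈T / τ⌉₊ + 1), ‖τ⁻¹ • d j‖) ?_
  filter_upwards [ae_restrict_mem measurableSet_Ioo] with t ht
  refine Finset.single_le_sum (f := fun j => ‖τ⁻¹ • d j‖) (fun _ _ => norm_nonneg _) ?_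
  rw [Finset.mem_range, Nat.lt_succ_iff]
  exact Nat.ceil_mono (div_le_div_of_nonneg_right ht.2.le hτ.le)

theorem intervalIntegral_natCeil [CompleteSpace E] {τ : ℝ} (hτ : 0 < τ) (f : ℕ → E) (k : ℕ) :
    IntervalIntegrable (fun t : ℝ => f ⌈t / τ⌉₊) volume 0 (k * τ) ∧
      ∫ t in (0 : ℝ)..(k * τ), f ⌈t / τ⌉₊ = τ • ∑ j ∈ Finset.range k, f (j + 1) := by
  induction k with
  | zero => simp
  | succ k ih =>
    have hle : (k : ℝ) * τ ≤ (k + 1 : ℕ) * τ := by push_cast; nlinarith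
    have h1 : Set.EqOn (fun _ => f (k + 1)) (fun t : ℝ => f ⌈t / τ⌉₊)
        (Set.uIoc (k * τ) ((k + 1 : ℕ) * τ)) := by
      rw [Set.uIoc_of_le hle]
      intro t ht
      simp only [natCeil_div_eq hτ ht]
    have h2 : IntervalIntegrable (fun t : ℝ => f ⌈t / τ⌉₊) volume (k * τ) ((k + 1 : ℕ) * τ) :=
      intervalIntegrable_const.congr h1
    refine ⟨ih.1.trans h2, ?_⟩
    rw [← intervalIntegral.integral_add_adjacent_intervals ih.1 h2, ih.2,
      ← intervalIntegral.integral_congr_ae (Eventually.of_forall fun t ht => h1 ht), intervalIntegral.integral_const,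
      Finset.sum_range_succ, smul_add]
    congr 2
    push_cast; ring

theorem primitive_stepRate [CompleteSpace E] {T τ : ℝ} (hτ : 0 < τ) (d : ℕ → E) {k : ℕ}
    (hk : k * τ ≤ T) :
    primitive (timeMeasure T) (stepRate τ d) (k * τ) = ∑ j ∈ Finset.range k, d (j + 1) := by
  rw [primitive_timeMeasure ⟨by positivity, hk⟩]
  have := (intervalIntegral_natCeil hτ (fun k => τ⁻¹ • d k) k).2
  simp only [stepRate]
  rw [this, ← Finset.smul_sum, smul_smul, mul_inv_cancel₀ hτ.ne', one_smul]

theorem primitive_stepRate_congr {T τ : ℝ} (hτ : 0 < τ) {d d' : ℕ → E} {k : ℕ}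
    (h : ∀ j ≤ k, d j = d' j) {t : ℝ} (ht : t ≤ k * τ) :
    primitive (timeMeasure T) (stepRate τ d) t = primitive (timeMeasure T) (stepRate τ d') t := by
  refine setIntegral_congr_fun measurableSet_Iic fun s hs => ?_
  exact stepRate_congr hτ h (le_trans hs ht)

theorem historyOp_stepRate_congr {X : Type*} [NormedAddCommGroup X] [NormedSpace ℝ X]
    {T τ : ℝ} (hτ : 0 < τ) (B : sobolevW1 1 T (E →L[ℝ] X)) (y₀ : X) {d d' : ℕ → E} {k : ℕ}
    (h : ∀ j ≤ k, d j = d' j) :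
    historyOp B y₀ (primitive (timeMeasure T) (stepRate τ d)) (k * τ)
      = historyOp B y₀ (primitive (timeMeasure T) (stepRate τ d')) (k * τ) := by
  rw [historyOp, historyOp]
  congr 1
  refine intervalIntegral.integral_congr_ae (Eventually.of_forall fun s hs => ?_)
  rw [Set.uIoc_of_le (by positivity)] at hs
  rw [primitive_stepRate_congr hτ h hs.2]

/-- Recursive definition of a sequence whose next element may depend on all previous ones. -/
theorem exists_seq_of_causal {E : Type*} (z : E) (F : ℕ → (ℕ → E) → E)
    (hF : ∀ k d d', (∀ j ≤ k, d j = d' j) → F k d = F k d') :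
    ∃ d : ℕ → E, d 0 = z ∧ ∀ k, d (k + 1) = F k d := by
  let G : ℕ → ℕ → E := fun n => Nat.rec (fun _ => z)
    (fun k Gk => Function.update Gk (k + 1) (F k Gk)) n
  have hG : ∀ n, G (n + 1) = Function.update (G n) (n + 1) (F n (G n)) := fun _ => rfl
  have hst : ∀ n, ∀ j ≤ n, G n j = G j j := by
    intro n
    induction n with
    | zero => intro j hj; rw [Nat.le_zero.1 hj]
    | succ n ih =>
      intro j hj
      rcases hj.eq_or_lt with h | h
      · rw [h]
      · rw [hG, Function.update_of_ne h.ne, ih j (Nat.lt_succ_iff.1 h)]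
  refine ⟨fun n => G n n, rfl, fun k => ?_⟩
  change G (k + 1) (k + 1) = _
  rw [hG, Function.update_self]
  exact hF k _ _ (hst k)

end stepFunctions

/-- Cauchy-Schwarz inequality on a time interval. -/
theorem sq_setIntegral_Ioc_le {T : ℝ} {h : ℝ → ℝ} (hi : Integrable h (timeMeasure T))
    (hi2 : Integrable (fun t => h t ^ 2) (timeMeasure T)) {s t : ℝ} (hst : s ≤ t) :
    (∫ u in Set.Ioc s t, h u ∂(timeMeasure T)) ^ 2
      ≤ (t - s) * ∫ u in Set.Ioc s t, h u ^ 2 ∂(timeMeasure T) := by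
  rcases hst.eq_or_lt with h0 | h0
  · simp [h0]
  have hm : (timeMeasure T).real (Set.Ioc s t) ≤ t - s := by
    refine ENNReal.toReal_le_of_le_ofReal (sub_nonneg.2 hst) ?_
    exact (Measure.restrict_apply_le _ _).trans_eq Real.volume_Ioc
  set I := ∫ u in Set.Ioc s t, h u ∂(timeMeasure T)
  set J := ∫ u in Set.Ioc s t, h u ^ 2 ∂(timeMeasure T)
  have hts : 0 < t - s := sub_pos.2 h0
  set c := I / (t - s) with hc
  have h1 : 0 ≤ ∫ u in Set.Ioc s t, (h u - c) ^ 2 ∂(timeMeasure T) :=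
    integral_nonneg fun _ => sq_nonneg _
  have h2 : ∫ u in Set.Ioc s t, (h u - c) ^ 2 ∂(timeMeasure T)
      = J - 2 * c * I + c ^ 2 * (timeMeasure T).real (Set.Ioc s t) := by
    have h3 : ∀ u, (h u - c) ^ 2 = h u ^ 2 - 2 * c * h u + c ^ 2 := fun u => by ring
    simp only [h3]
    rw [integral_add, integral_sub, integral_const_mul, integral_const]
    · simp [mul_comm, J, I]
    · exact hi2.integrableOn
    · exact (hi.const_mul _).integrableOn
    · exact (hi2.sub (hi.const_mul _)).integrableOn
    · exact integrable_const _
  have h4 : c ^ 2 * (timeMeasure T).real (Set.Ioc s t) ≤ c ^ 2 * (t - s) :=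
    mul_le_mul_of_nonneg_left hm (sq_nonneg c)
  have h5 : I = c * (t - s) := by rw [hc]; field_simp
  rw [h5]
  rw [h2, h5] at h1
  nlinarith

/-! ### The time discretisation -/

section scheme

variable {X Y : Type*} [NormedAddCommGroup X] [NormedSpace ℝ X]
    [NormedAddCommGroup Y] [InnerProductSpace ℝ Y]

/-- The driving force `ℓ(t) - A q(t) = -∂_q E(t, q(t))`. -/
noncomputable def drivingForce (A : Y →L[ℝ] Y) (l : ℝ → StrongDual ℝ Y) (q : ℝ → Y) (t : ℝ) :
    StrongDual ℝ Y := l t - innerSL ℝ (A (q t))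

/-- By positive homogeneity, a subgradient `ξ` of `R(ζ, ·)` at `d` is dominated by `R(ζ, ·)`, with
equality at `d`. -/
theorem IsDissipation.apply_eq_and_le {R : X → Y → ℝ≥0∞} {D : Set Y} (hR : IsDissipation R D)
    {ζ : X} {ξ : StrongDual ℝ Y} {d : Y} (hd : d ∈ D)
    (h : ∀ v ∈ D, (R ζ d).toReal + ξ (v - d) ≤ (R ζ v).toReal) :
    ξ d = (R ζ d).toReal ∧ ∀ v ∈ D, ξ v ≤ (R ζ v).toReal := by
  have h0 := h 0 hR.zero_mem
  rw [hR.apply_zero, ENNReal.toReal_zero, map_sub, map_zero] at h0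
  have h2 := h ((2 : ℝ) • d) (hR.smul_mem zero_le_two hd)
  rw [hR.toReal_smul ζ zero_le_two, map_sub, map_smul, smul_eq_mul] at h2
  have heq : ξ d = (R ζ d).toReal := by linarith
  refine ⟨heq, fun v hv => ?_⟩
  have h3 := h v hv
  rw [map_sub] at h3
  linarith

variable [CompleteSpace Y]

/-- The time discretisation, explicit in the history variable and implicit in the state. -/
theorem exists_scheme {T τ : ℝ} (hτ : 0 < τ) {A : Y →L[ℝ] Y} (hA : IsSelfAdjoint A) {α : ℝ}
    (hα : 0 < α) (hcoer : ∀ y : Y, α * ‖y‖ ^ 2 ≤ inner ℝ (A y) y) {R : X → Y → ℝ≥0∞} {D : Set Y}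
    (hR : IsDissipation R D) (B : sobolevW1 1 T (Y →L[ℝ] X)) (y₀ : X)
    (l : ℝ → StrongDual ℝ Y) :
    ∃ d : ℕ → Y, ∀ k : ℕ, (k + 1 : ℕ) * τ ≤ T → d (k + 1) ∈ D ∧ ∀ v ∈ D,
      (R (historyOp B y₀ (primitive (timeMeasure T) (stepRate τ d)) (k * τ)) (d (k + 1))).toReal
        + drivingForce A l (primitive (timeMeasure T) (stepRate τ d)) ((k + 1 : ℕ) * τ)
          (v - d (k + 1))
      ≤ (R (historyOp B y₀ (primitive (timeMeasure T) (stepRate τ d)) (k * τ)) v).toReal := by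
  have hres : ∀ (ζ : X) (f : StrongDual ℝ Y), ∃ η ∈ D, ∀ v ∈ D,
      (R ζ η).toReal + (f (v - η) - inner ℝ (A η) (v - η)) ≤ (R ζ v).toReal := by
    intro ζ f
    obtain ⟨η, h1, h2⟩ := exists_resolvent hA hα hcoer (hR.convex ζ) (hR.lowerSemicontinuous ζ)
      (hR.proper ζ) f
    exact ⟨η, hR.ne_top_iff.1 h1, fun v hv => h2 v (hR.ne_top_iff.2 hv)⟩
  choose res hmem hvar using hres
  obtain ⟨d, -, hd⟩ := exists_seq_of_causal (0 : Y) (fun k d =>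
    res (historyOp B y₀ (primitive (timeMeasure T) (stepRate τ d)) (k * τ))
      (l ((k + 1 : ℕ) * τ)
        - innerSL ℝ (A (primitive (timeMeasure T) (stepRate τ d) (k * τ))))) (by
    intro k d d' h
    rw [historyOp_stepRate_congr hτ B y₀ h, primitive_stepRate_congr hτ h le_rfl])
  refine ⟨d, fun k hk => ⟨by rw [hd]; exact hmem _ _, fun v hv => ?_⟩⟩
  have hk' : (k : ℝ) * τ ≤ T := by push_cast at hk; nlinarith
  have h := hvar (historyOp B y₀ (primitive (timeMeasure T) (stepRate τ d)) (k * τ))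
      (l ((k + 1 : ℕ) * τ)
        - innerSL ℝ (A (primitive (timeMeasure T) (stepRate τ d) (k * τ)))) v hv
  rw [← hd k] at h
  refine le_trans (le_of_eq ?_) h
  rw [drivingForce, primitive_stepRate hτ d hk, primitive_stepRate hτ d hk',
    Finset.sum_range_succ, map_add, map_add]
  simp only [sub_apply, add_apply, innerSL_apply_apply]
  ring

end scheme

/-! ### A priori estimates and consistency -/

section estimates

/-- Discrete Gronwall inequality. -/
theorem sum_le_of_increment_le {T τ c : ℝ} (hτ : 0 < τ) (hc : 0 ≤ c) {Γ : ℝ → ℝ} {x : ℕ → ℝ}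
    (hΓ0 : ∀ t, 0 ≤ Γ t)
    (hΓ : ∀ k : ℕ, Γ (k * τ) ≤ Γ ((k + 1 : ℕ) * τ))
    (h : ∀ k : ℕ, (k + 1 : ℕ) * τ ≤ T → x (k + 1) ≤ (Γ ((k + 1 : ℕ) * τ) - Γ (k * τ))
      + c * τ * ∑ j ∈ Finset.range k, x (j + 1)) (k : ℕ) (hk : k * τ ≤ T) :
    ∑ j ∈ Finset.range k, x (j + 1) ≤ Real.exp (c * (k * τ)) * Γ (k * τ) := by
  induction k with
  | zero => simpa using hΓ0 0
  | succ k ih =>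
    have hk' : (k : ℝ) * τ ≤ T := by push_cast at hk; nlinarith
    have h1 := ih hk'
    have h2 := h k hk
    rw [Finset.sum_range_succ]
    set S := ∑ j ∈ Finset.range k, x (j + 1)
    have h3 : 1 + c * τ ≤ Real.exp (c * τ) := by linarith [Real.add_one_le_exp (c * τ)]
    have h4 : Real.exp (c * ((k + 1 : ℕ) * τ)) = Real.exp (c * τ) * Real.exp (c * (k * τ)) := by
      rw [← Real.exp_add]; congr 1; push_cast; ring
    have h5 : 1 ≤ Real.exp (c * ((k + 1 : ℕ) * τ)) := Real.one_le_exp (by positivity)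
    calc S + x (k + 1) ≤ (1 + c * τ) * S + (Γ ((k + 1 : ℕ) * τ) - Γ (k * τ)) := by linarith
      _ ≤ (1 + c * τ) * (Real.exp (c * (k * τ)) * Γ (k * τ))
          + (Γ ((k + 1 : ℕ) * τ) - Γ (k * τ)) := by gcongr
      _ ≤ Real.exp (c * τ) * (Real.exp (c * (k * τ)) * Γ (k * τ))
          + Real.exp (c * ((k + 1 : ℕ) * τ)) * (Γ ((k + 1 : ℕ) * τ) - Γ (k * τ)) := by
        have h6 : 0 ≤ Real.exp (c * (k * τ)) * Γ (k * τ) := mul_nonneg (Real.exp_pos _).le (hΓ0 _)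
        have h7 := mul_le_mul_of_nonneg_right h3 h6
        have h8 := mul_le_mul_of_nonneg_right h5 (sub_nonneg.2 (hΓ k))
        linarith
      _ = _ := by rw [h4]; ring

/-- The square-summed form of the increment estimate, after the Gronwall bound `K` on the sums. -/
theorem sum_sq_le_of_increment_le {τ α c K : ℝ} (hτ : 0 < τ) (hα : 0 < α) (hc : 0 ≤ c)
    {Γ Γ₂ : ℝ → ℝ} {x : ℕ → ℝ} (hx : ∀ k, 0 ≤ x k)
    (hCS : ∀ j : ℕ, (Γ ((j + 1 : ℕ) * τ) - Γ (j * τ)) ^ 2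
      ≤ τ * (Γ₂ ((j + 1 : ℕ) * τ) - Γ₂ (j * τ)))
    (hΓ₂0 : 0 ≤ Γ₂ ((0 : ℕ) * τ)) (n : ℕ)
    (hinc : ∀ k, k + 1 ≤ n → x (k + 1) ≤ (Γ ((k + 1 : ℕ) * τ) / α - Γ (k * τ) / α)
        + c * τ * ∑ j ∈ Finset.range k, x (j + 1))
    (hsum : ∀ k ≤ n, ∑ j ∈ Finset.range k, x (j + 1) ≤ K) :
    ∑ j ∈ Finset.range n, τ⁻¹ * x (j + 1) ^ 2
      ≤ 2 / α ^ 2 * Γ₂ (n * τ) + 2 * (c * K) ^ 2 * (n * τ) := by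
  have h2 : ∀ j ∈ Finset.range n, τ⁻¹ * x (j + 1) ^ 2
      ≤ 2 / α ^ 2 * (Γ₂ ((j + 1 : ℕ) * τ) - Γ₂ (j * τ)) + 2 * (c * K) ^ 2 * τ := by
    intro j hj
    have hj' : j + 1 ≤ n := Finset.mem_range.1 hj
    have h4 := hsum j (by omega)
    have h5 : x (j + 1) ≤ (Γ ((j + 1 : ℕ) * τ) - Γ (j * τ)) / α + c * τ * K := by
      rw [sub_div]
      exact (hinc j hj').trans (by gcongr)
    have h6 := hCS j
    set a := Γ ((j + 1 : ℕ) * τ) - Γ (j * τ) with ha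
    set b := Γ₂ ((j + 1 : ℕ) * τ) - Γ₂ (j * τ) with hb
    have h8 : x (j + 1) ^ 2 ≤ 2 * (a / α) ^ 2 + 2 * (c * τ * K) ^ 2 := by
      have h9 := pow_le_pow_left₀ (hx _) h5 2
      nlinarith [sq_nonneg (a / α - c * τ * K)]
    calc τ⁻¹ * x (j + 1) ^ 2 ≤ τ⁻¹ * (2 * (a / α) ^ 2 + 2 * (c * τ * K) ^ 2) := by gcongr
      _ = τ⁻¹ * (2 / α ^ 2 * a ^ 2) + 2 * (c * K) ^ 2 * τ := by field_simp
      _ ≤ τ⁻¹ * (2 / α ^ 2 * (τ * b)) + 2 * (c * K) ^ 2 * τ := by gcongr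
      _ = _ := by field_simp
  refine (Finset.sum_le_sum h2).trans ?_
  rw [Finset.sum_add_distrib, ← Finset.mul_sum,
    Finset.sum_range_sub (fun j : ℕ => Γ₂ (j * τ)) n, Finset.sum_const, Finset.card_range,
    nsmul_eq_mul]
  have h4 : (n : ℝ) * (2 * (c * K) ^ 2 * τ) = 2 * (c * K) ^ 2 * (n * τ) := by ring
  rw [h4]
  gcongr
  linarith

variable {X Y : Type*} [NormedAddCommGroup X] [NormedSpace ℝ X] [CompleteSpace X]
    [NormedAddCommGroup Y] [InnerProductSpace ℝ Y] [CompleteSpace Y]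

theorem historyOp_zero {X Y : Type*} [NormedAddCommGroup X] [NormedSpace ℝ X]
    [NormedAddCommGroup Y] [NormedSpace ℝ Y] {T : ℝ} (B : sobolevW1 1 T (Y →L[ℝ] X)) (y₀ : X)
    (q : ℝ → Y) : historyOp B y₀ q 0 = y₀ := by
  rw [historyOp, intervalIntegral.integral_same, zero_add]

/-- The increments of the scheme are estimated by testing the inclusion at the previous time with
the current increment. The compatibility condition provides the inclusion at time `0`. -/
theorem norm_increment_le {T τ : ℝ} (hτ : 0 < τ) {A : Y →L[ℝ] Y} {α : ℝ}
    (hcoer : ∀ y : Y, α * ‖y‖ ^ 2 ≤ inner ℝ (A y) y) {R : X → Y → ℝ≥0∞} {D : Set Y}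
    (hR : IsDissipation R D) {L : ℝ} (hL0 : 0 ≤ L) (hL : ∀ ζ₁ ζ₂ : X, ∀ η₁ ∈ D, ∀ η₂ ∈ D,
      (R ζ₁ η₂).toReal - (R ζ₁ η₁).toReal + (R ζ₂ η₁).toReal - (R ζ₂ η₂).toReal
        ≤ L * ‖ζ₁ - ζ₂‖ * ‖η₁ - η₂‖)
    (B : sobolevW1 1 T (Y →L[ℝ] X)) (y₀ : X) {M : ℝ} (hM : 0 ≤ M)
    (hB : ∀ᵐ t ∂(timeMeasure T), ‖B.1.fst t‖ ≤ M) {l : ℝ → StrongDual ℝ Y} {Γ : ℝ → ℝ}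
    (hl : ∀ s t, 0 ≤ s → s ≤ t → t ≤ T → ‖l t - l s‖ ≤ Γ t - Γ s)
    (hcomp : ∀ v ∈ D, l 0 v ≤ (R y₀ v).toReal) {d : ℕ → Y}
    (hd : ∀ k : ℕ, (k + 1 : ℕ) * τ ≤ T → d (k + 1) ∈ D ∧ ∀ v ∈ D,
      (R (historyOp B y₀ (primitive (timeMeasure T) (stepRate τ d)) (k * τ)) (d (k + 1))).toReal
        + drivingForce A l (primitive (timeMeasure T) (stepRate τ d)) ((k + 1 : ℕ) * τ)
          (v - d (k + 1))
      ≤ (R (historyOp B y₀ (primitive (timeMeasure T) (stepRate τ d)) (k * τ)) v).toReal)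
    {k : ℕ} (hk : (k + 1 : ℕ) * τ ≤ T) :
    α * ‖d (k + 1)‖ ≤ (Γ ((k + 1 : ℕ) * τ) - Γ (k * τ))
      + L * (M * τ * ∑ j ∈ Finset.range k, ‖d (j + 1)‖) := by
  set q := primitive (timeMeasure T) (stepRate τ d) with hq
  set H := historyOp B y₀ q with hH
  have hk' : (k : ℝ) * τ ≤ T := by push_cast at hk; nlinarith
  have hint : Integrable (stepRate τ d) (timeMeasure T) := (memLp_stepRate hτ d).integrable le_top
  have hqk : q ((k + 1 : ℕ) * τ) = q (k * τ) + d (k + 1) := by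
    rw [hq, primitive_stepRate hτ d hk, primitive_stepRate hτ d hk', Finset.sum_range_succ]
  have hpos : 0 ≤ ∑ j ∈ Finset.range k, ‖d (j + 1)‖ := Finset.sum_nonneg fun _ _ => norm_nonneg _
  obtain ⟨hdD, hvar⟩ := hd k hk
  obtain ⟨heq, -⟩ := hR.apply_eq_and_le hdD hvar
  -- A history value `ζ` at the previous step for which the inclusion at time `k τ` is known.
  obtain ⟨ζ, hζ, hprev⟩ : ∃ ζ : X, ‖H (k * τ) - ζ‖ ≤ M * τ * ∑ j ∈ Finset.range k, ‖d (j + 1)‖ ∧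
      ∀ v ∈ D, drivingForce A l q (k * τ) v ≤ (R ζ v).toReal := by
    rcases k with _ | k
    · refine ⟨y₀, ?_, fun v hv => ?_⟩
      · simp [hH, historyOp_zero]
      · have h0 : q 0 = 0 := primitive_timeMeasure_of_nonpos le_rfl _
        simpa [drivingForce, h0] using hcomp v hv
    · obtain ⟨h1, h2⟩ := hd k hk'
      refine ⟨H (k * τ), ?_, (hR.apply_eq_and_le h1 h2).2⟩
      have h3 := norm_historyOp_sub_le B y₀ hM hB hint (s := k * τ) (t := (k + 1 : ℕ) * τ)
        (by positivity) (by push_cast; nlinarith) hk'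
      refine h3.trans (le_of_eq ?_)
      simp only [norm_stepRate hτ]
      rw [primitive_stepRate hτ _ hk']
      push_cast; ring
  have h1 := hprev _ hdD
  have h2 := hR.toReal_le_add hL ζ (H (k * τ)) hdD
  have h3 : drivingForce A l q (k * τ) (d (k + 1))
      - drivingForce A l q ((k + 1 : ℕ) * τ) (d (k + 1))
      = inner ℝ (A (d (k + 1))) (d (k + 1)) - (l ((k + 1 : ℕ) * τ) - l (k * τ)) (d (k + 1)) := by
    simp only [drivingForce, hqk, sub_apply, map_add, innerSL_apply_apply, add_apply]
    ring
  have h4 : (l ((k + 1 : ℕ) * τ) - l (k * τ)) (d (k + 1))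
      ≤ (Γ ((k + 1 : ℕ) * τ) - Γ (k * τ)) * ‖d (k + 1)‖ := by
    refine (Real.le_norm_self _).trans ((ContinuousLinearMap.le_opNorm _ _).trans ?_)
    exact mul_le_mul_of_nonneg_right
      (hl _ _ (by positivity) (by push_cast; nlinarith) hk) (norm_nonneg _)
  have h5 := hcoer (d (k + 1))
  have h6 : L * ‖ζ - H (k * τ)‖ * ‖d (k + 1)‖
      ≤ L * (M * τ * ∑ j ∈ Finset.range k, ‖d (j + 1)‖) * ‖d (k + 1)‖ := by
    rw [norm_sub_rev]
    gcongr
  rcases (norm_nonneg (d (k + 1))).eq_or_lt with h0 | h0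
  · rw [← h0, mul_zero]
    have := (norm_nonneg _).trans (hl (k * τ) ((k + 1 : ℕ) * τ) (by positivity)
      (by push_cast; nlinarith) hk)
    positivity
  · refine le_of_mul_le_mul_right ?_ h0
    nlinarith

set_option maxHeartbeats 800000 in
/-- The piecewise affine interpolants of the scheme are bounded in `H¹` independently of the step
size, and they satisfy the inclusion up to an error that vanishes with the step size. -/
theorem exists_approximate_solution {T : ℝ} (hT : 0 < T) {A : Y →L[ℝ] Y} (hA : IsSelfAdjoint A)
    {α : ℝ} (hα : 0 < α) (hcoer : ∀ y : Y, α * ‖y‖ ^ 2 ≤ inner ℝ (A y) y) {R : X → Y → ℝ≥0∞}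
    {D : Set Y} (hR : IsDissipation R D) (B : sobolevW1 1 T (Y →L[ℝ] X)) (y₀ : X)
    {l g : ℝ → StrongDual ℝ Y} (hg : MemLp g 2 (timeMeasure T))
    (hl : ∀ s t, 0 ≤ s → s ≤ t → t ≤ T →
      ‖l t - l s‖ ≤ ∫ u in Set.Ioc s t, ‖g u‖ ∂(timeMeasure T))
    (hcomp : ∀ v ∈ D, l 0 v ≤ (R y₀ v).toReal) :
    ∃ C : ℝ, ∀ κ > 0, ∃ r : Lp Y 2 (timeMeasure T), ‖r‖ ≤ C ∧ ∀ᵐ t ∂(timeMeasure T), r t ∈ D ∧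
      ∀ w ∈ D, (R (historyOp B y₀ (primitive (timeMeasure T) r) t) (r t)).toReal
          + drivingForce A l (primitive (timeMeasure T) r) t (w - r t)
        ≤ (R (historyOp B y₀ (primitive (timeMeasure T) r) t) w).toReal
          + κ * (‖r t‖ + ‖w‖) := by
  obtain ⟨M, hM, hB⟩ := exists_ae_bound_of_mem_sobolevW1 hT B
  obtain ⟨L, hL0, hL⟩ := hR.mixedLipschitz
  have hgi : Integrable (fun u => ‖g u‖) (timeMeasure T) := (hg.integrable one_le_two).norm
  have hg2 : Integrable (fun u => ‖g u‖ ^ 2) (timeMeasure T) := hg.integrable_norm_pow two_ne_zero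
  set Γ := primitive (timeMeasure T) (fun u => ‖g u‖) with hΓ
  set Γ₂ := primitive (timeMeasure T) (fun u => ‖g u‖ ^ 2) with hΓ₂
  have hΓ0 : ∀ t, 0 ≤ Γ t := fun t => integral_nonneg fun _ => norm_nonneg _
  have hΓ₂0 : ∀ t, 0 ≤ Γ₂ t := fun t => integral_nonneg fun _ => sq_nonneg _
  have hΓmono : Monotone Γ := fun s t hst => by
    rw [← sub_nonneg, hΓ, primitive_sub_primitive hgi hst]
    exact integral_nonneg fun _ => norm_nonneg _
  have hΓ₂mono : Monotone Γ₂ := fun s t hst => by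
    rw [← sub_nonneg, hΓ₂, primitive_sub_primitive hg2 hst]
    exact integral_nonneg fun _ => sq_nonneg _
  have hl' : ∀ s t, 0 ≤ s → s ≤ t → t ≤ T → ‖l t - l s‖ ≤ Γ t - Γ s := fun s t h1 h2 h3 => by
    rw [hΓ, primitive_sub_primitive hgi h2]; exact hl s t h1 h2 h3
  have hCS : ∀ s t, s ≤ t → (Γ t - Γ s) ^ 2 ≤ (t - s) * (Γ₂ t - Γ₂ s) := fun s t hst => by
    rw [hΓ, hΓ₂, primitive_sub_primitive hgi hst, primitive_sub_primitive hg2 hst]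
    exact sq_setIntegral_Ioc_le hgi hg2 hst
  set c := L * M / α with hc
  have hc0 : 0 ≤ c := by positivity
  set K := Real.exp (c * T) * (Γ T / α) with hK
  have hK0 : 0 ≤ K := mul_nonneg (Real.exp_pos _).le (div_nonneg (hΓ0 T) hα.le)
  set C2 := 2 / α ^ 2 * Γ₂ T + 2 * (c * K) ^ 2 * T with hC2
  have hC20 : 0 ≤ C2 := by have := hΓ₂0 T; positivity
  refine ⟨√C2, fun κ hκ => ?_⟩
  -- The consistency error of the scheme with step size `τ`.
  have hlim : Tendsto (fun N : ℕ => L * (M * (T / (N + 1 : ℕ)) * K)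
      + (√(T / (N + 1 : ℕ) * Γ₂ T) + ‖A‖ * √(T / (N + 1 : ℕ) * C2))) atTop
      (𝓝 (L * (M * 0 * K) + (√(0 * Γ₂ T) + ‖A‖ * √(0 * C2)))) := by
    have h0 : Tendsto (fun N : ℕ => T / (N + 1 : ℕ)) atTop (𝓝 0) :=
      (tendsto_const_div_atTop_nhds_zero_nat T).comp (tendsto_add_atTop_nat 1)
    have hcont : Continuous fun τ : ℝ => L * (M * τ * K) + (√(τ * Γ₂ T) + ‖A‖ * √(τ * C2)) := by
      fun_prop
    exact (hcont.tendsto 0).comp h0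
  simp only [mul_zero, zero_mul, Real.sqrt_zero, add_zero] at hlim
  obtain ⟨N, hN⟩ := (hlim.eventually_lt_const hκ).exists
  set τ := T / (N + 1 : ℕ) with hτdef
  have hτ : 0 < τ := by positivity
  have hNτ : ((N + 1 : ℕ) : ℝ) * τ = T := by rw [hτdef]; field_simp
  obtain ⟨d, hd⟩ := exists_scheme (T := T) hτ hA hα hcoer hR B y₀ l
  have hmem : MemLp (stepRate τ d) 2 (timeMeasure T) := (memLp_stepRate hτ d).mono_exponent le_top
  have hint : Integrable (stepRate τ d) (timeMeasure T) := hmem.integrable one_le_two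
  have hint2 : Integrable (fun t => ‖stepRate τ d t‖ ^ 2) (timeMeasure T) :=
    hmem.integrable_norm_pow two_ne_zero
  have hmono : ∀ k : ℕ, (k : ℝ) * τ ≤ (k + 1 : ℕ) * τ := fun k => by push_cast; nlinarith
  have hle : ∀ k ≤ N + 1, (k : ℝ) * τ ≤ T := fun k hk => by
    rw [← hNτ]; exact mul_le_mul_of_nonneg_right (by exact_mod_cast hk) hτ.le
  have hinc : ∀ k : ℕ, (k + 1 : ℕ) * τ ≤ T → ‖d (k + 1)‖
      ≤ (Γ ((k + 1 : ℕ) * τ) / α - Γ (k * τ) / α)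
        + c * τ * ∑ j ∈ Finset.range k, ‖d (j + 1)‖ := by
    intro k hk
    have h := norm_increment_le hτ hcoer hR hL0 hL B y₀ hM hB hl' hcomp hd hk
    refine le_of_mul_le_mul_left (h.trans (le_of_eq ?_)) hα
    rw [hc]; field_simp
  have hsum : ∀ k ≤ N + 1, ∑ j ∈ Finset.range k, ‖d (j + 1)‖ ≤ K := by
    intro k hk
    have h := sum_le_of_increment_le (x := fun k => ‖d k‖) (Γ := fun t => Γ t / α) hτ hc0
      (fun t => div_nonneg (hΓ0 t) hα.le)
      (fun k => div_le_div_of_nonneg_right (hΓmono (hmono k)) hα.le) hinc k (hle k hk)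
    refine h.trans ?_
    have h1 := hΓmono (hle k hk)
    have h2 := hle k hk
    have h3 := hΓ0 (k * τ)
    rw [hK]
    gcongr
  have hS1 : primitive (timeMeasure T) (fun t => ‖stepRate τ d t‖) T ≤ K := by
    have h := primitive_stepRate (T := T) hτ (fun k => ‖d k‖) (hle (N + 1) le_rfl)
    rw [hNτ] at h
    simp only [norm_stepRate hτ]
    exact h.trans_le (hsum _ le_rfl)
  have hS2 : ∫ t, ‖stepRate τ d t‖ ^ 2 ∂(timeMeasure T) ≤ C2 := by
    have h1 := (intervalIntegral_natCeil hτ (fun k => ‖τ⁻¹ • d k‖ ^ 2) (N + 1)).2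
    rw [hNτ, intervalIntegral.integral_of_le hT.le, integral_Ioc_eq_integral_Ioo] at h1
    change ∫ t, ‖stepRate τ d t‖ ^ 2 ∂(timeMeasure T) = _ at h1
    rw [h1, smul_eq_mul, Finset.mul_sum]
    calc ∑ j ∈ Finset.range (N + 1), τ * ‖τ⁻¹ • d (j + 1)‖ ^ 2
        = ∑ j ∈ Finset.range (N + 1), τ⁻¹ * ‖d (j + 1)‖ ^ 2 := by
          refine Finset.sum_congr rfl fun j _ => ?_
          rw [norm_smul, norm_inv, Real.norm_of_nonneg hτ.le]
          field_simp
      _ ≤ C2 := by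
          have h2 := sum_sq_le_of_increment_le (x := fun k => ‖d k‖) hτ hα hc0
            (fun k => norm_nonneg _) (fun j => by
              have h6 := hCS _ _ (hmono j)
              have h7 : ((j + 1 : ℕ) : ℝ) * τ - j * τ = τ := by push_cast; ring
              rwa [h7] at h6) (hΓ₂0 _) (N + 1) (fun j hj => hinc j (hle _ hj))
            (fun j hj => hsum j hj)
          rwa [hNτ] at h2
  set r : Lp Y 2 (timeMeasure T) := hmem.toLp with hr
  have hrr : r =ᵐ[timeMeasure T] stepRate τ d := hmem.coeFn_toLp
  refine ⟨r, ?_, ?_⟩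
  · refine Real.le_sqrt_of_sq_le ?_
    rw [← real_inner_self_eq_norm_sq, L2.inner_def]
    refine le_trans (le_of_eq (integral_congr_ae ?_)) hS2
    filter_upwards [hrr] with t ht
    rw [ht, real_inner_self_eq_norm_sq]
  rw [primitive_congr hrr]
  filter_upwards [hrr, ae_restrict_mem measurableSet_Ioo] with t hrt ht
  rw [hrt]
  obtain ⟨k, hkN, htk⟩ : ∃ k : ℕ, k + 1 ≤ N + 1 ∧ t ∈ Set.Ioc (k * τ) ((k + 1 : ℕ) * τ) := by
    have hpos : 0 < ⌈t / τ⌉₊ := Nat.ceil_pos.2 (div_pos ht.1 hτ)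
    obtain ⟨k, hk⟩ := Nat.exists_eq_succ_of_ne_zero hpos.ne'
    refine ⟨k, ?_, ?_⟩
    · rw [← Nat.succ_eq_add_one, ← hk, Nat.ceil_le, div_le_iff₀ hτ, hNτ]
      exact ht.2.le
    · have h := (Nat.ceil_eq_iff (by simp)).1 hk
      rw [lt_div_iff₀ hτ, div_le_iff₀ hτ] at h
      simpa using h
  obtain ⟨hdD, hvar⟩ := hd k (hle _ hkN)
  obtain ⟨heq, hdom⟩ := hR.apply_eq_and_le hdD hvar
  set q := primitive (timeMeasure T) (stepRate τ d) with hq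
  set H := historyOp B y₀ q with hH
  set t' := ((k + 1 : ℕ) : ℝ) * τ with ht'
  have ht'T : t' ≤ T := hle _ hkN
  have htt' : t' - t ≤ τ := by
    have := htk.1
    rw [ht']; push_cast; linarith
  have hstep : stepRate τ d t = τ⁻¹ • d (k + 1) := stepRate_eq hτ d htk
  have hDt : stepRate τ d t ∈ D := by rw [hstep]; exact hR.smul_mem (by positivity) hdD
  have heq' : drivingForce A l q t' (stepRate τ d t) = (R (H (k * τ)) (stepRate τ d t)).toReal := by
    rw [hstep, map_smul, heq, hR.toReal_smul _ (by positivity), smul_eq_mul]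
  refine ⟨hDt, fun w hw => ?_⟩
  set ρ := stepRate τ d t with hρ
  have hHerr : ‖H t - H (k * τ)‖ ≤ M * τ * K := by
    refine (norm_historyOp_sub_le B y₀ hM hB hint (by positivity) htk.1.le ht.2.le).trans ?_
    have h1 : t - k * τ ≤ τ := by
      have := htk.2
      rw [ht'] at this; push_cast at this; linarith
    have h2 : primitive (timeMeasure T) (fun u => ‖stepRate τ d u‖) t ≤ K := by
      refine le_trans ?_ hS1
      rw [← sub_nonneg, primitive_sub_primitive hint.norm ht.2.le]
      exact integral_nonneg fun _ => norm_nonneg _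
    have h3 : 0 ≤ primitive (timeMeasure T) (fun u => ‖stepRate τ d u‖) t :=
      integral_nonneg fun _ => norm_nonneg _
    gcongr
  have hqerr : ‖q t' - q t‖ ≤ √(τ * C2) := by
    rw [hq, primitive_sub_primitive hint htk.2]
    refine (norm_integral_le_integral_norm _).trans (Real.le_sqrt_of_sq_le ?_)
    refine (sq_setIntegral_Ioc_le hint.norm hint2 htk.2).trans ?_
    have h1 : ∫ u in Set.Ioc t t', ‖stepRate τ d u‖ ^ 2 ∂(timeMeasure T) ≤ C2 :=
      (setIntegral_le_integral hint2 (Eventually.of_forall fun _ => sq_nonneg _)).trans hS2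
    have h2 : 0 ≤ ∫ u in Set.Ioc t t', ‖stepRate τ d u‖ ^ 2 ∂(timeMeasure T) :=
      integral_nonneg fun _ => sq_nonneg _
    gcongr
  have hlerr : ‖l t' - l t‖ ≤ √(τ * Γ₂ T) := by
    refine (hl' t t' ht.1.le htk.2 ht'T).trans (Real.le_sqrt_of_sq_le ?_)
    refine (hCS t t' htk.2).trans ?_
    have h1 : Γ₂ t' - Γ₂ t ≤ Γ₂ T := by linarith [hΓ₂mono ht'T, hΓ₂0 t]
    have h2 : 0 ≤ Γ₂ t' - Γ₂ t := sub_nonneg.2 (hΓ₂mono htk.2)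
    gcongr
  have hferr : ‖drivingForce A l q t - drivingForce A l q t'‖
      ≤ √(τ * Γ₂ T) + ‖A‖ * √(τ * C2) := by
    have h1 : drivingForce A l q t - drivingForce A l q t'
        = innerSL ℝ (A (q t' - q t)) - (l t' - l t) := by
      simp only [drivingForce, map_sub]; abel
    rw [h1]
    refine (norm_sub_le _ _).trans ?_
    rw [innerSL_apply_norm, add_comm]
    exact add_le_add hlerr ((A.le_opNorm _).trans (by gcongr))
  have e1 := hR.toReal_le_add hL (H t) (H (k * τ)) hDt
  have e2 := hR.toReal_le_add hL (H (k * τ)) (H t) hw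
  have e3 := hdom w hw
  have e4 : (drivingForce A l q t - drivingForce A l q t') (w - ρ)
      ≤ (√(τ * Γ₂ T) + ‖A‖ * √(τ * C2)) * (‖ρ‖ + ‖w‖) := by
    refine (Real.le_norm_self _).trans ((ContinuousLinearMap.le_opNorm _ _).trans ?_)
    refine mul_le_mul hferr ((norm_sub_le _ _).trans_eq (add_comm _ _)) (norm_nonneg _)
      (by positivity)
  have e5 : L * ‖H t - H (k * τ)‖ * ‖ρ‖ ≤ L * (M * τ * K) * ‖ρ‖ := by gcongr
  have e6 : L * ‖H (k * τ) - H t‖ * ‖w‖ ≤ L * (M * τ * K) * ‖w‖ := by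
    rw [norm_sub_rev]; gcongr
  have e7 := mul_le_mul_of_nonneg_right hN.le (by positivity : 0 ≤ ‖ρ‖ + ‖w‖)
  rw [sub_apply, map_sub, map_sub] at e4
  rw [map_sub]
  linarith

end estimates

/-! ### Weak convergence in Hilbert spaces -/

section weakConvergence

variable {H : Type*} [NormedAddCommGroup H] [InnerProductSpace ℝ H] [CompleteSpace H]

/-- A bounded sequence in a Hilbert space has a weakly convergent subsequence. No separability is
needed, as everything happens in the closed span of the sequence. -/
theorem exists_subseq_tendsto_inner {x : ℕ → H} {C : ℝ} (hx : ∀ n, ‖x n‖ ≤ C) :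
    ∃ (y : H) (φ : ℕ → ℕ), StrictMono φ ∧
      ∀ z : H, Tendsto (fun n => inner ℝ (x (φ n)) z) atTop (𝓝 (inner ℝ y z)) := by
  set K : Submodule ℝ H := (Submodule.span ℝ (Set.range x)).topologicalClosure with hK
  have hsep : TopologicalSpace.IsSeparable (K : Set H) := by
    rw [hK, Submodule.topologicalClosure_coe]
    exact (TopologicalSpace.IsSeparable.span (R := ℝ)
      (Set.countable_range x).isSeparable).closure
  have : TopologicalSpace.SeparableSpace K := hsep.separableSpace
  have : CompleteSpace K := (Submodule.isClosed_topologicalClosure _).completeSpace_coe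
  have hxK : ∀ n, x n ∈ K := fun n =>
    Submodule.le_topologicalClosure _ (Submodule.subset_span ⟨n, rfl⟩)
  obtain ⟨ξ, -, φ, hφ, hlim⟩ := WeakDual.isSeqCompact_closedBall ℝ K (0 : StrongDual ℝ K) C
    (x := fun n => StrongDual.toWeakDual (innerSL ℝ (⟨x n, hxK n⟩ : K))) (fun n => by
      rw [Set.mem_preimage, mem_closedBall_zero_iff]
      change ‖innerSL ℝ (⟨x n, hxK n⟩ : K)‖ ≤ C
      rw [innerSL_apply_norm]
      exact hx n)
  rw [tendsto_iff_forall_eval_tendsto_topDualPairing] at hlim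
  set y : K := (InnerProductSpace.toDual ℝ K).symm (WeakDual.toStrongDual ξ) with hy
  refine ⟨y, φ, hφ, fun z => ?_⟩
  have hproj : ∀ w : K, inner ℝ (w : H) z = inner ℝ w (K.orthogonalProjectionOnto z) := fun w =>
    (Submodule.inner_orthogonalProjectionOnto_eq_of_mem_left w z).symm
  have h := hlim (K.orthogonalProjectionOnto z)
  have h2 : inner ℝ (y : H) z = (topDualPairing ℝ K ξ) (K.orthogonalProjectionOnto z) := by
    rw [hproj, hy, InnerProductSpace.toDual_symm_apply]
    rfl
  rw [h2]
  refine h.congr fun n => ?_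
  exact (hproj ⟨x (φ n), hxK (φ n)⟩).symm

omit [CompleteSpace H] in
theorem tendsto_inner_of_weak_of_strong {x y : ℕ → H} {x' y' : H} {C : ℝ} (hC : ∀ n, ‖x n‖ ≤ C)
    (hx : ∀ z : H, Tendsto (fun n => inner ℝ (x n) z) atTop (𝓝 (inner ℝ x' z)))
    (hy : Tendsto y atTop (𝓝 y')) :
    Tendsto (fun n => inner ℝ (x n) (y n)) atTop (𝓝 (inner ℝ x' y')) := by
  have h0 : Tendsto (fun n => inner ℝ (x n) (y n - y')) atTop (𝓝 0) := by
    refine squeeze_zero_norm (a := fun n => C * ‖y n - y'‖) (fun n => ?_) ?_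
    · exact (norm_inner_le_norm _ _).trans (mul_le_mul_of_nonneg_right (hC n) (norm_nonneg _))
    · simpa using (tendsto_iff_norm_sub_tendsto_zero.1 hy).const_mul C
  have h1 := h0.add (hx y')
  rw [zero_add] at h1
  exact h1.congr fun n => by rw [← inner_add_right, sub_add_cancel]

/-- A bounded linear map between Hilbert spaces is weakly continuous. -/
theorem tendsto_inner_clm {G : Type*} [NormedAddCommGroup G] [InnerProductSpace ℝ G]
    [CompleteSpace G] (S : H →L[ℝ] G) {x : ℕ → H} {x' : H}
    (hx : ∀ z : H, Tendsto (fun n => inner ℝ (x n) z) atTop (𝓝 (inner ℝ x' z))) (z : G) :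
    Tendsto (fun n => inner ℝ (S (x n)) z) atTop (𝓝 (inner ℝ (S x') z)) := by
  simp only [← ContinuousLinearMap.adjoint_inner_right]
  exact hx _

end weakConvergence

/-! ### The primitive as an operator on `L²(0,T;Y)` -/

section primitiveOperator

variable {Y : Type*} [NormedAddCommGroup Y] [InnerProductSpace ℝ Y]

theorem integral_norm_le_of_Lp {T : ℝ} (hT : 0 ≤ T) (r : Lp Y 2 (timeMeasure T)) :
    ∫ t, ‖r t‖ ∂(timeMeasure T) ≤ √T * ‖r‖ := by
  have hm := Lp.memLp r
  have hIoc : ∀ f : ℝ → ℝ, ∫ t in Set.Ioc 0 T, f t ∂(timeMeasure T) = ∫ t, f t ∂(timeMeasure T) := by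
    intro f
    rw [Measure.restrict_eq_self_of_ae_mem]
    filter_upwards [ae_restrict_mem measurableSet_Ioo] with t ht using ⟨ht.1, ht.2.le⟩
  have h := sq_setIntegral_Ioc_le (hm.integrable one_le_two).norm
    (hm.integrable_norm_pow two_ne_zero) hT
  rw [hIoc, hIoc] at h
  have h2 : ∫ t, ‖r t‖ ^ 2 ∂(timeMeasure T) = ‖r‖ ^ 2 := by
    rw [← real_inner_self_eq_norm_sq, L2.inner_def]
    simp only [real_inner_self_eq_norm_sq]
  rw [h2, sub_zero] at h
  refine le_of_sq_le_sq ?_ (by positivity)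
  rwa [mul_pow, Real.sq_sqrt hT]

theorem memLp_primitive {T : ℝ} (r : Lp Y 2 (timeMeasure T)) :
    MemLp (primitive (timeMeasure T) r) 2 (timeMeasure T) :=
  MemLp.of_bound (continuous_primitive (integrable_Lp_timeMeasure r)).aestronglyMeasurable _
    (Eventually.of_forall (norm_primitive_le (integrable_Lp_timeMeasure r)))

/-- The operator that maps `r ∈ L²(0,T;Y)` to its primitive `t ↦ ∫₀ᵗ r`. -/
noncomputable def primitiveL {T : ℝ} (hT : 0 ≤ T) :
    Lp Y 2 (timeMeasure T) →L[ℝ] Lp Y 2 (timeMeasure T) :=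
  LinearMap.mkContinuous
    { toFun := fun r => MemLp.toLp _ (memLp_primitive r)
      map_add' := by
        intro r r'
        rw [← MemLp.toLp_add, MemLp.toLp_eq_toLp_iff]
        refine Eventually.of_forall fun t => ?_
        rw [primitive_congr (Lp.coeFn_add r r')]
        exact integral_add (integrable_Lp_timeMeasure r).integrableOn
          (integrable_Lp_timeMeasure r').integrableOn
      map_smul' := by
        intro c r
        rw [RingHom.id_apply, ← MemLp.toLp_const_smul, MemLp.toLp_eq_toLp_iff]
        refine Eventually.of_forall fun t => ?_
        rw [primitive_congr (Lp.coeFn_smul c r)]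
        exact integral_smul c _ }
    (measureUnivNNReal (timeMeasure T) ^ (2 : ℝ≥0∞).toReal⁻¹ * √T) (fun r => by
      rw [mul_assoc]
      refine Lp.norm_le_of_ae_bound (by positivity) ?_
      filter_upwards [MemLp.coeFn_toLp (memLp_primitive r)] with t ht
      change ‖MemLp.toLp _ (memLp_primitive r) t‖ ≤ _
      rw [ht]
      exact (norm_primitive_le (integrable_Lp_timeMeasure r) t).trans (integral_norm_le_of_Lp hT r))

theorem coeFn_primitiveL {T : ℝ} (hT : 0 ≤ T) (r : Lp Y 2 (timeMeasure T)) :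
    primitiveL hT r =ᵐ[timeMeasure T] primitive (timeMeasure T) r :=
  MemLp.coeFn_toLp (memLp_primitive r)

variable [CompleteSpace Y]

/-- The element of `H¹₀(0,T;Y)` with a given rate `r ∈ L²(0,T;Y)`, that is, the pair of the
primitive of `r` and `r` itself. -/
noncomputable def h10OfRate {T : ℝ} (hT : 0 < T) :
    Lp Y 2 (timeMeasure T) →L[ℝ] sobolevH10 T Y :=
  ((WithLp.prodContinuousLinearEquiv 2 ℝ (Lp Y 2 (timeMeasure T))
      (Lp Y 2 (timeMeasure T))).symm.toContinuousLinearMap ∘L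
    (primitiveL hT.le).prod (ContinuousLinearMap.id ℝ _)).codRestrict (sobolevH10 T Y) (by
    intro r
    refine ⟨fun φ hφ hc hs => ?_, primitive (timeMeasure T) r,
      (continuous_primitive (integrable_Lp_timeMeasure r)).continuousOn, coeFn_primitiveL hT.le r,
      primitive_timeMeasure_of_nonpos le_rfl _⟩
    have h := hasWeakDeriv_primitive hT (integrable_Lp_timeMeasure r) φ hφ hc hs
    refine Eq.trans (integral_congr_ae ?_) h
    filter_upwards [coeFn_primitiveL hT.le r] with t ht
    exact congrArg _ ht)

theorem h10Rate_h10OfRate {T : ℝ} (hT : 0 < T) (r : Lp Y 2 (timeMeasure T)) :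
    h10Rate (h10OfRate hT r) = r := rfl

theorem h10Val_h10OfRate {T : ℝ} (hT : 0 < T) (r : Lp Y 2 (timeMeasure T)) :
    h10Val (h10OfRate hT r) =ᵐ[timeMeasure T] primitive (timeMeasure T) r :=
  coeFn_primitiveL hT.le r

theorem tendsto_toWeakSpace_h10OfRate {T : ℝ} (hT : 0 < T) {r : ℕ → Lp Y 2 (timeMeasure T)}
    {r' : Lp Y 2 (timeMeasure T)}
    (hr : ∀ z, Tendsto (fun n => inner ℝ (r n) z) atTop (𝓝 (inner ℝ r' z))) :
    Tendsto (fun n => toWeakSpace ℝ (sobolevH10 T Y) (h10OfRate hT (r n))) atTop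
      (𝓝 (toWeakSpace ℝ (sobolevH10 T Y) (h10OfRate hT r'))) := by
  refine (WeakBilin.tendsto_iff_forall_eval_tendsto _ ?_).2 fun φ => ?_
  · intro x y hxy
    by_contra hne
    obtain ⟨f, hf⟩ := SeparatingDual.exists_separating_of_ne (R := ℝ) hne
    exact hf (DFunLike.congr_fun hxy f)
  · set z := (InnerProductSpace.toDual ℝ (Lp Y 2 (timeMeasure T))).symm (φ ∘L h10OfRate hT) with hz
    have h : ∀ x, φ (h10OfRate hT x) = inner ℝ x z := fun x => by
      rw [real_inner_comm, hz, InnerProductSpace.toDual_symm_apply]; rfl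
    have h1 := hr z
    simp only [← h] at h1
    exact h1

theorem historyOp_h10OfRate {X : Type*} [NormedAddCommGroup X] [NormedSpace ℝ X] {T : ℝ}
    (hT : 0 < T) (B : sobolevW1 1 T (Y →L[ℝ] X)) (y₀ : X) (r : Lp Y 2 (timeMeasure T)) {t : ℝ}
    (ht : t ∈ Set.Icc 0 T) : historyOp B y₀ (h10Val (h10OfRate hT r)) t
      = historyOp B y₀ (primitive (timeMeasure T) r) t := by
  rw [historyOp, historyOp, intervalIntegral.integral_of_le ht.1,
    intervalIntegral.integral_of_le ht.1, ← timeMeasure_restrict_Iic ht]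
  congr 1
  refine integral_congr_ae (ae_restrict_of_ae ?_)
  filter_upwards [h10Val_h10OfRate hT r] with s hs
  rw [hs]

/-- `∫₀ᵀ (A q, q̇) dt = ½ (A q(T), q(T)) ≥ 0` for `q` with `q(0) = 0`. -/
theorem inner_primitiveL_nonneg {T : ℝ} (hT : 0 ≤ T) {A : Y →L[ℝ] Y} (hA : IsSelfAdjoint A)
    (hpos : ∀ y : Y, 0 ≤ inner ℝ (A y) y) (r : Lp Y 2 (timeMeasure T)) :
    0 ≤ inner ℝ (A.compLpL 2 (timeMeasure T) (primitiveL hT r)) r := by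
  have hr := integrable_Lp_timeMeasure r
  have h1 : inner ℝ (A.compLpL 2 (timeMeasure T) (primitiveL hT r)) r
      = ∫ t, inner ℝ (A (primitive (timeMeasure T) r t)) (r t) ∂(timeMeasure T) := by
    rw [L2.inner_def]
    refine integral_congr_ae ?_
    filter_upwards [A.coeFn_compLpL (primitiveL hT r), coeFn_primitiveL hT r] with t h1 h2
    rw [h1, h2]
  have h := integral_bilin_primitive_add ((innerSL ℝ : Y →L[ℝ] Y →L[ℝ] ℝ) ∘L A) hr hr
  change _ + ∫ t, inner ℝ (A (r t)) (primitive (timeMeasure T) r t) ∂(timeMeasure T)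
    = inner ℝ (A (∫ t, r t ∂(timeMeasure T))) (∫ t, r t ∂(timeMeasure T)) at h
  have h2 : ∀ t, inner ℝ (A (r t)) (primitive (timeMeasure T) r t)
      = inner ℝ (A (primitive (timeMeasure T) r t)) (r t) := fun t => by
    rw [real_inner_comm]; exact (hA.isSymmetric _ _).symm
  simp only [h2] at h
  change ∫ t, inner ℝ (A (primitive (timeMeasure T) r t)) (r t) ∂(timeMeasure T) + _ = _ at h
  rw [h1]
  linarith [hpos (∫ t, r t ∂(timeMeasure T))]

end primitiveOperator

/-! ### Integrated inequalities and measurability -/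

section integration

/-- Integration of a pointwise inequality between extended functionals, for which no measurability
of `f` and `g` is needed. -/
theorem lintegral_add_integral_le {Ω : Type*} [MeasurableSpace Ω] {μ : Measure Ω}
    {f g : Ω → ℝ≥0∞} {h : Ω → ℝ} (hh : Integrable h μ)
    (hfg : ∀ᵐ x ∂μ, f x ≠ ⊤ ∧ g x ≠ ⊤ ∧ (f x).toReal + h x ≤ (g x).toReal)
    (hg : ∫⁻ x, g x ∂μ ≠ ⊤) :
    ∫⁻ x, f x ∂μ ≠ ⊤ ∧ (∫⁻ x, f x ∂μ).toReal + ∫ x, h x ∂μ ≤ (∫⁻ x, g x ∂μ).toReal := by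
  have hp : ∫⁻ x, ENNReal.ofReal (h x) ∂μ ≠ ⊤ := hh.lintegral_lt_top.ne
  have hn : ∫⁻ x, ENNReal.ofReal (-h x) ∂μ ≠ ⊤ := hh.neg.lintegral_lt_top.ne
  have hnm : AEMeasurable (fun x => ENNReal.ofReal (-h x)) μ :=
    hh.1.aemeasurable.neg.ennreal_ofReal
  have hle : ∫⁻ x, f x ∂μ + ∫⁻ x, ENNReal.ofReal (h x) ∂μ
      ≤ ∫⁻ x, g x ∂μ + ∫⁻ x, ENNReal.ofReal (-h x) ∂μ := by
    rw [← lintegral_add_right' _ hh.1.aemeasurable.ennreal_ofReal,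
      ← lintegral_add_right' _ hnm]
    refine lintegral_mono_ae ?_
    filter_upwards [hfg] with x ⟨h1, h2, h3⟩
    rw [← ENNReal.ofReal_toReal h1, ← ENNReal.ofReal_toReal h2]
    rcases le_total 0 (h x) with h4 | h4
    · rw [ENNReal.ofReal_of_nonpos (neg_nonpos.2 h4), add_zero,
        ← ENNReal.ofReal_add ENNReal.toReal_nonneg h4]
      exact ENNReal.ofReal_le_ofReal h3
    · rw [ENNReal.ofReal_of_nonpos h4, add_zero,
        ← ENNReal.ofReal_add ENNReal.toReal_nonneg (neg_nonneg.2 h4)]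
      exact ENNReal.ofReal_le_ofReal (by linarith)
  have hfin : ∫⁻ x, f x ∂μ ≠ ⊤ :=
    ne_top_of_le_ne_top (ENNReal.add_ne_top.2 ⟨hg, hn⟩) (le_self_add.trans hle)
  refine ⟨hfin, ?_⟩
  have h1 := ENNReal.toReal_mono (ENNReal.add_ne_top.2 ⟨hg, hn⟩) hle
  rw [ENNReal.toReal_add hfin hp, ENNReal.toReal_add hg hn] at h1
  rw [integral_eq_lintegral_pos_part_sub_lintegral_neg_part hh]
  linarith

variable {X Y : Type*} [NormedAddCommGroup X] [NormedSpace ℝ X]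
    [NormedAddCommGroup Y] [NormedSpace ℝ Y] {R : X → Y → ℝ≥0∞} {D : Set Y}

/-- The mixed Lipschitz estimate makes `R` lower semicontinuous in both arguments jointly. -/
theorem IsDissipation.lowerSemicontinuous_uncurry (hR : IsDissipation R D) :
    LowerSemicontinuous (fun p : X × Y => R p.1 p.2) := by
  obtain ⟨L, hL0, hL⟩ := hR.mixedLipschitz
  rintro ⟨ζ, η⟩ c hc
  obtain ⟨c', hcc', hc'⟩ := exists_between hc
  have h1 : ∀ᶠ p : X × Y in 𝓝 (ζ, η), c' < R ζ p.2 :=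
    (continuous_snd.tendsto (ζ, η)).eventually (hR.lowerSemicontinuous ζ η c' hc')
  have h2 : Tendsto (fun p : X × Y => c + ENNReal.ofReal (L * ‖ζ - p.1‖ * ‖p.2‖)) (𝓝 (ζ, η))
      (𝓝 (c + ENNReal.ofReal (L * ‖ζ - ζ‖ * ‖η‖))) := by
    refine Tendsto.const_add c (ENNReal.tendsto_ofReal ?_)
    exact (by fun_prop : Continuous fun p : X × Y => L * ‖ζ - p.1‖ * ‖p.2‖).tendsto (ζ, η)
  simp only [sub_self, norm_zero, mul_zero, zero_mul, ENNReal.ofReal_zero, add_zero] at h2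
  filter_upwards [h1, h2.eventually_lt_const hcc'] with p hp1 hp2
  by_cases hpD : p.2 ∈ D
  · have h3 := hR.toReal_le_add hL ζ p.1 hpD
    have h4 : R ζ p.2 ≤ R p.1 p.2 + ENNReal.ofReal (L * ‖ζ - p.1‖ * ‖p.2‖) := by
      rw [← ENNReal.ofReal_toReal (hR.ne_top_iff.2 hpD : R ζ p.2 ≠ ⊤),
        ← ENNReal.ofReal_toReal (hR.ne_top_iff.2 hpD : R p.1 p.2 ≠ ⊤),
        ← ENNReal.ofReal_add ENNReal.toReal_nonneg (by positivity)]
      exact ENNReal.ofReal_le_ofReal h3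
    exact (ENNReal.add_lt_add_iff_right ENNReal.ofReal_ne_top).1 (hp2.trans (hp1.trans_le h4))
  · have h3 : R p.1 p.2 = ⊤ := by
      by_contra h
      exact hpD (hR.ne_top_iff.1 h)
    change c < R p.1 p.2
    rw [h3]
    exact hc.trans_le le_top

theorem IsDissipation.aemeasurable_comp (hR : IsDissipation R D) {Ω : Type*} [MeasurableSpace Ω]
    {μ : Measure Ω} {ζ : Ω → X} {r : Ω → Y} (hζ : AEStronglyMeasurable ζ μ)
    (hr : AEStronglyMeasurable r μ) : AEMeasurable (fun t => R (ζ t) (r t)) μ := by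
  let _ : MeasurableSpace (X × Y) := borel _
  have : BorelSpace (X × Y) := ⟨rfl⟩
  exact hR.lowerSemicontinuous_uncurry.measurable.comp_aemeasurable (hζ.prodMk hr).aemeasurable

end integration

/-! ### Loads -/

section loads

variable {Y : Type*} [NormedAddCommGroup Y] [InnerProductSpace ℝ Y]

/-- The continuous representative of an `H¹` function is absolutely continuous. -/
theorem exists_norm_sub_le_of_memH1 {E : Type*} [NormedAddCommGroup E] [NormedSpace ℝ E]
    [CompleteSpace E] {T : ℝ} (hT : 0 < T) {l : ℝ → E} (hl : MemH1 T l)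
    (hc : ContinuousOn l (Set.Icc 0 T)) :
    ∃ g : ℝ → E, MemLp g 2 (timeMeasure T) ∧ ∀ s t, 0 ≤ s → s ≤ t → t ≤ T →
      ‖l t - l s‖ ≤ ∫ u in Set.Ioc s t, ‖g u‖ ∂(timeMeasure T) := by
  obtain ⟨w, hw, hwl⟩ := hl
  have hg := integrable_Lp_timeMeasure w.snd
  obtain ⟨c, hcw⟩ := HasWeakDeriv.ae_eq_const_add_primitive hT
    (integrable_Lp_timeMeasure w.fst) hg hw
  have heq : Set.EqOn l (fun t => c + primitive (timeMeasure T) w.snd t) (Set.Icc 0 T) := by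
    refine Measure.eqOn_Icc_of_ae_eq volume hT.ne ?_ hc
      (continuous_const.add (continuous_primitive hg)).continuousOn
    rw [← Measure.restrict_congr_set Ioo_ae_eq_Icc]
    exact hwl.symm.trans hcw
  refine ⟨w.snd, Lp.memLp _, fun s t hs hst ht => ?_⟩
  rw [heq ⟨hs.trans hst, ht⟩, heq ⟨hs, hst.trans ht⟩, add_sub_add_left_eq_sub,
    primitive_sub_primitive hg hst]
  exact norm_integral_le_integral_norm _

theorem exists_Lp_inner_eq_of_memH1 [CompleteSpace Y] {T : ℝ} {l : ℝ → StrongDual ℝ Y} (hl : MemH1 T l) :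
    ∃ f : Lp Y 2 (timeMeasure T), ∀ᵐ t ∂(timeMeasure T), ∀ y, inner ℝ (f t) y = l t y := by
  obtain ⟨w, -, hwl⟩ := hl
  have hm : MemLp (fun t => (InnerProductSpace.toDual ℝ Y).symm (w.fst t)) 2 (timeMeasure T) :=
    (Lp.memLp w.fst).of_le ((InnerProductSpace.toDual ℝ Y).symm.continuous.comp_aestronglyMeasurable
      (Lp.memLp w.fst).1) (Eventually.of_forall fun t => by rw [LinearIsometryEquiv.norm_map])
  refine ⟨hm.toLp, ?_⟩
  filter_upwards [hm.coeFn_toLp, hwl] with t h1 h2 y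
  rw [h1, InnerProductSpace.toDual_symm_apply, h2]

theorem drivingForce_eq_inner {T : ℝ} (hT : 0 ≤ T) (A : Y →L[ℝ] Y) {l : ℝ → StrongDual ℝ Y}
    {f : Lp Y 2 (timeMeasure T)}
    (hf : ∀ᵐ t ∂(timeMeasure T), ∀ y, inner ℝ (f t) y = l t y) (r : Lp Y 2 (timeMeasure T)) :
    ∀ᵐ t ∂(timeMeasure T), ∀ y, drivingForce A l (primitive (timeMeasure T) r) t y
      = inner ℝ ((f - A.compLpL 2 (timeMeasure T) (primitiveL hT r) : Lp Y 2 (timeMeasure T)) t) y := by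
  filter_upwards [hf, A.coeFn_compLpL (primitiveL hT r), coeFn_primitiveL hT r,
    Lp.coeFn_sub f (A.compLpL 2 (timeMeasure T) (primitiveL hT r))] with t h1 h2 h3 h4 y
  rw [h4, Pi.sub_apply, h2, h3, inner_sub_left, h1]
  rfl

end loads

/-! ### Passage to the limit -/

section limitPassage

theorem tendsto_rate {Y : Type*} [NormedAddCommGroup Y] [InnerProductSpace ℝ Y] {T : ℝ} {w : ℕ → sobolevH10 T Y} {v : sobolevH10 T Y}
    (h : Tendsto w atTop (𝓝 v)) :
    Tendsto (fun m => (w m).1.snd) atTop (𝓝 v.1.snd) := by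
  have hc : Continuous fun x : sobolevH10 T Y => x.1.snd :=
    continuous_snd.comp ((WithLp.prodContinuousLinearEquiv 2 ℝ (Lp Y 2 (timeMeasure T))
      (Lp Y 2 (timeMeasure T))).continuous.comp continuous_subtype_val)
  exact (hc.tendsto v).comp h

variable {X Y : Type*} [NormedAddCommGroup X] [NormedSpace ℝ X]
    [NormedAddCommGroup Y] [InnerProductSpace ℝ Y] [CompleteSpace Y]

/-- The integrated variational inequality of an approximate solution. -/
theorem totalDissipation_add_inner_le {T : ℝ} (hT : 0 < T) {A : Y →L[ℝ] Y} {R : X → Y → ℝ≥0∞}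
    {D : Set Y} (hR : IsDissipation R D) (B : sobolevW1 1 T (Y →L[ℝ] X)) (y₀ : X)
    {l : ℝ → StrongDual ℝ Y} {f : Lp Y 2 (timeMeasure T)}
    (hf : ∀ᵐ t ∂(timeMeasure T), ∀ y, inner ℝ (f t) y = l t y) {κ : ℝ} (hκ : 0 ≤ κ)
    {r : Lp Y 2 (timeMeasure T)}
    (hr : ∀ᵐ t ∂(timeMeasure T), r t ∈ D ∧
      ∀ w ∈ D, (R (historyOp B y₀ (primitive (timeMeasure T) r) t) (r t)).toReal
          + drivingForce A l (primitive (timeMeasure T) r) t (w - r t)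
        ≤ (R (historyOp B y₀ (primitive (timeMeasure T) r) t) w).toReal
          + κ * (‖r t‖ + ‖w‖))
    {w : sobolevH10 T Y} (hw : w ∈ admissible T D)
    (hfin : totalDissipation R B y₀ (h10OfRate hT r) w ≠ ⊤) :
    totalDissipation R B y₀ (h10OfRate hT r) (h10OfRate hT r) ≠ ⊤ ∧
      (totalDissipation R B y₀ (h10OfRate hT r) (h10OfRate hT r)).toReal
          + (inner ℝ (f - A.compLpL 2 (timeMeasure T) (primitiveL hT.le r)) (w.1.snd - r)
            - κ * (√T * (‖r‖ + ‖w.1.snd‖)))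
        ≤ (totalDissipation R B y₀ (h10OfRate hT r) w).toReal := by
  set F : Lp Y 2 (timeMeasure T) := f - A.compLpL 2 (timeMeasure T) (primitiveL hT.le r) with hF
  have hi1 : Integrable (fun t => inner ℝ (F t) ((w.1.snd - r : Lp Y 2 (timeMeasure T)) t))
      (timeMeasure T) := L2.integrable_inner F _
  have hi2 : Integrable (fun t => ‖r t‖) (timeMeasure T) := (integrable_Lp_timeMeasure r).norm
  have hi3 : Integrable (fun t => ‖w.1.snd t‖) (timeMeasure T) :=
    (integrable_Lp_timeMeasure w.1.snd).norm
  have hi4 : Integrable (fun t => ‖r t‖ + ‖w.1.snd t‖) (timeMeasure T) := hi2.add hi3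
  have key := lintegral_add_integral_le (μ := timeMeasure T)
    (f := fun t => R (historyOp B y₀ (h10Val (h10OfRate hT r)) t) (h10Rate (h10OfRate hT r) t))
    (g := fun t => R (historyOp B y₀ (h10Val (h10OfRate hT r)) t) (h10Rate w t))
    (hi1.sub (hi4.const_mul κ)) (by
      filter_upwards [hr, hw, drivingForce_eq_inner hT.le A hf r, Lp.coeFn_sub w.1.snd r,
        ae_restrict_mem measurableSet_Ioo] with t h1 h2 h3 h4 ht
      rw [historyOp_h10OfRate hT B y₀ r (Set.Ioo_subset_Icc_self ht), h10Rate_h10OfRate]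
      refine ⟨hR.ne_top_iff.2 h1.1, hR.ne_top_iff.2 h2, ?_⟩
      have h5 := h1.2 _ h2
      rw [h3] at h5
      simp only [Pi.sub_apply, h4]
      change _ + (inner ℝ (F t) (h10Rate w t - r t) - κ * (‖r t‖ + ‖h10Rate w t‖)) ≤ _
      linarith) hfin
  refine ⟨key.1, le_trans ?_ key.2⟩
  refine add_le_add le_rfl ?_
  have h1 : ∫ t, (inner ℝ (F t) ((w.1.snd - r : Lp Y 2 (timeMeasure T)) t)
        - κ * (‖r t‖ + ‖w.1.snd t‖)) ∂(timeMeasure T)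
      = inner ℝ F (w.1.snd - r)
        - κ * (∫ t, ‖r t‖ ∂(timeMeasure T) + ∫ t, ‖w.1.snd t‖ ∂(timeMeasure T)) := by
    rw [integral_sub hi1 (hi4.const_mul κ), integral_const_mul, integral_add hi2 hi3,
      L2.inner_def]
  refine le_trans ?_ h1.ge
  have h2 := integral_norm_le_of_Lp hT.le r
  have h3 := integral_norm_le_of_Lp hT.le w.1.snd
  have h4 := mul_le_mul_of_nonneg_left (add_le_add h2 h3) hκ
  rw [← mul_add] at h4
  linarith

/-- The weak limit of the approximate solutions satisfies the integrated variational inequality: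
the dissipation passes to the limit by the convergence assumption, the quadratic term
`∫₀ᵀ (A q, q̇) dt` by weak lower semicontinuity. -/
theorem exists_solution_integrated [CompleteSpace X] {T : ℝ} (hT : 0 < T) {A : Y →L[ℝ] Y}
    (hA : IsSelfAdjoint A) {α : ℝ} (hα : 0 < α)
    (hcoer : ∀ y : Y, α * ‖y‖ ^ 2 ≤ inner ℝ (A y) y) {R : X → Y → ℝ≥0∞} {D : Set Y}
    (hR : IsDissipation R D) (B : sobolevW1 1 T (Y →L[ℝ] X)) (y₀ : X)
    (hconv : ConvergenceAssumption R D B y₀) {l g : ℝ → StrongDual ℝ Y}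
    (hg : MemLp g 2 (timeMeasure T))
    (hl : ∀ s t, 0 ≤ s → s ≤ t → t ≤ T →
      ‖l t - l s‖ ≤ ∫ u in Set.Ioc s t, ‖g u‖ ∂(timeMeasure T))
    (hcomp : ∀ v ∈ D, l 0 v ≤ (R y₀ v).toReal) {f : Lp Y 2 (timeMeasure T)}
    (hf : ∀ᵐ t ∂(timeMeasure T), ∀ y, inner ℝ (f t) y = l t y) :
    ∃ r : Lp Y 2 (timeMeasure T), ∀ v ∈ admissible T D,
      totalDissipation R B y₀ (h10OfRate hT r) v ≠ ⊤ →
      totalDissipation R B y₀ (h10OfRate hT r) (h10OfRate hT r) ≠ ⊤ ∧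
      (totalDissipation R B y₀ (h10OfRate hT r) (h10OfRate hT r)).toReal
          + inner ℝ (f - A.compLpL 2 (timeMeasure T) (primitiveL hT.le r)) (v.1.snd - r)
        ≤ (totalDissipation R B y₀ (h10OfRate hT r) v).toReal := by
  obtain ⟨C, happrox⟩ := exists_approximate_solution hT hA hα hcoer hR B y₀ hg hl hcomp
  have hκ0 : ∀ m : ℕ, (0 : ℝ) < 1 / ((m : ℝ) + 1) := fun m => by positivity
  choose x hxC hx using fun m : ℕ => happrox (1 / ((m : ℝ) + 1)) (hκ0 m)
  obtain ⟨r', φ, hφ, hweak⟩ := exists_subseq_tendsto_inner hxC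
  set r : ℕ → Lp Y 2 (timeMeasure T) := fun m => x (φ m) with hr
  set κ : ℕ → ℝ := fun m => 1 / ((φ m : ℝ) + 1) with hκ
  have hκlim : Tendsto κ atTop (𝓝 0) :=
    tendsto_one_div_add_atTop_nhds_zero_nat.comp hφ.tendsto_atTop
  have hrC : ∀ m, ‖r m‖ ≤ C := fun m => hxC _
  have hadm : ∀ m, h10OfRate hT (r m) ∈ admissible T D := fun m => by
    filter_upwards [hx (φ m)] with t ht using ht.1
  have hweakH := tendsto_toWeakSpace_h10OfRate hT hweak
  refine ⟨r', fun v hv hfin => ?_⟩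
  obtain ⟨w, hwadm, hwlim, hlimsup⟩ := hconv.recovery _ _ hadm hweakH v hv
  have hliminf := hconv.liminf_le _ _ hadm hweakH
  set V := totalDissipation R B y₀ (h10OfRate hT r') v with hV
  set S : Lp Y 2 (timeMeasure T) →L[ℝ] Lp Y 2 (timeMeasure T) :=
    A.compLpL 2 (timeMeasure T) ∘L primitiveL hT.le with hS
  have hSpos : ∀ z, 0 ≤ inner ℝ (S z) z := fun z => inner_primitiveL_nonneg hT.le hA
    (fun y => le_trans (by positivity) (hcoer y)) z
  have hwr := tendsto_rate hwlim
  have hSr := tendsto_inner_clm S hweak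
  have hSC : ∀ m, ‖S (r m)‖ ≤ ‖S‖ * C := fun m =>
    (S.le_opNorm _).trans (mul_le_mul_of_nonneg_left (hrC m) (norm_nonneg _))
  -- A lower bound of the linear terms that converges.
  set c : ℕ → ℝ := fun m => inner ℝ f (w m).1.snd - inner ℝ (r m) f
    - inner ℝ (S (r m)) (w m).1.snd
    + (inner ℝ (r m) (S r') + inner ℝ (S (r m)) r' - inner ℝ (S r') r')
    - κ m * (√T * (C + ‖(w m).1.snd‖)) with hc
  have hclim : Tendsto c atTop (𝓝 (inner ℝ f v.1.snd - inner ℝ r' f - inner ℝ (S r') v.1.snd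
      + (inner ℝ r' (S r') + inner ℝ (S r') r' - inner ℝ (S r') r')
      - 0 * (√T * (C + ‖v.1.snd‖)))) := by
    refine Tendsto.sub (Tendsto.add (Tendsto.sub (Tendsto.sub (tendsto_const_nhds.inner hwr)
      (hweak f)) (tendsto_inner_of_weak_of_strong hSC hSr hwr)) (Tendsto.sub (Tendsto.add
      (hweak _) (hSr _)) tendsto_const_nhds)) (hκlim.mul ((hwr.norm.const_add C).const_mul _))
  have hclim' : Tendsto c atTop (𝓝 (inner ℝ (f - S r') (v.1.snd - r'))) := by
    convert hclim using 2
    rw [inner_sub_left, inner_sub_right, inner_sub_right, real_inner_comm r' f,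
      real_inner_comm r' (S r')]
    ring
  set c' := inner ℝ (f - S r') (v.1.snd - r') with hc'
  have hbound : ∀ m, totalDissipation R B y₀ (h10OfRate hT (r m)) (w m) ≠ ⊤ →
      totalDissipation R B y₀ (h10OfRate hT (r m)) (h10OfRate hT (r m)) ≠ ⊤ ∧
      (totalDissipation R B y₀ (h10OfRate hT (r m)) (h10OfRate hT (r m))).toReal + c m
        ≤ (totalDissipation R B y₀ (h10OfRate hT (r m)) (w m)).toReal := by
    intro m hm
    obtain ⟨h1, h2⟩ := totalDissipation_add_inner_le hT hR B y₀ hf (hκ0 (φ m)).le (hx (φ m))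
      (hwadm m) hm
    refine ⟨h1, le_trans (add_le_add le_rfl ?_) h2⟩
    change c m ≤ inner ℝ (f - S (r m)) ((w m).1.snd - r m)
      - κ m * (√T * (‖r m‖ + ‖(w m).1.snd‖))
    have h3 := hSpos (r m - r')
    rw [map_sub, inner_sub_left, inner_sub_right, inner_sub_right,
      real_inner_comm (r m) (S r')] at h3
    have h4 : κ m * (√T * (‖r m‖ + ‖(w m).1.snd‖)) ≤ κ m * (√T * (C + ‖(w m).1.snd‖)) := by
      have := (hκ0 (φ m)).le
      have := hrC m
      gcongr
    rw [inner_sub_left, inner_sub_right, inner_sub_right, real_inner_comm (r m) f]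
    simp only [hc]
    linarith
  have hδ : ∀ δ > 0, totalDissipation R B y₀ (h10OfRate hT r') (h10OfRate hT r') ≠ ⊤ ∧
      (totalDissipation R B y₀ (h10OfRate hT r') (h10OfRate hT r')).toReal + c'
        ≤ V.toReal + δ := by
    intro δ hδ
    have hVlt : V < ENNReal.ofReal (V.toReal + δ / 2) := by
      rw [ENNReal.lt_ofReal_iff_toReal_lt hfin]; linarith
    have h1 : ∀ᶠ m in atTop, totalDissipation R B y₀ (h10OfRate hT (r m)) (w m)
        < ENNReal.ofReal (V.toReal + δ / 2) := eventually_lt_of_limsup_lt (hlimsup.trans_lt hVlt)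
    have h2 : ∀ᶠ m in atTop, c' - δ / 2 < c m := hclim'.eventually_const_lt (by linarith)
    have hV0 : (0 : ℝ) ≤ V.toReal := ENNReal.toReal_nonneg
    have h3 : ∀ᶠ m in atTop, totalDissipation R B y₀ (h10OfRate hT (r m)) (h10OfRate hT (r m)) ≠ ⊤ ∧
        (totalDissipation R B y₀ (h10OfRate hT (r m)) (h10OfRate hT (r m))).toReal
          ≤ V.toReal + δ - c' := by
      filter_upwards [h1, h2] with m hm1 hm2
      have hne := hm1.ne_top
      obtain ⟨h4, h5⟩ := hbound m hne
      have h6 := (ENNReal.lt_ofReal_iff_toReal_lt hne).1 hm1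
      exact ⟨h4, by linarith⟩
    -- The bound is nonnegative, so that truncation at zero does not matter.
    have h0 : 0 ≤ V.toReal + δ - c' := by
      obtain ⟨m, -, hm⟩ := h3.exists
      exact ENNReal.toReal_nonneg.trans hm
    have h4 : totalDissipation R B y₀ (h10OfRate hT r') (h10OfRate hT r')
        ≤ ENNReal.ofReal (V.toReal + δ - c') := by
      refine hliminf.trans ((liminf_le_liminf (h3.mono fun m hm => ?_)).trans_eq
        (liminf_const (f := (atTop : Filter ℕ)) _))
      exact (ENNReal.le_ofReal_iff_toReal_le hm.1 h0).2 hm.2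
    have hne := ne_top_of_le_ne_top ENNReal.ofReal_ne_top h4
    refine ⟨hne, ?_⟩
    have h5 := (ENNReal.le_ofReal_iff_toReal_le hne h0).1 h4
    linarith
  exact ⟨(hδ 1 one_pos).1, le_of_forall_pos_le_add fun δ h => (hδ δ h).2⟩

end limitPassage

/-! ### From the integrated to the pointwise inclusion -/

section conclusion

variable {X Y : Type*} [NormedAddCommGroup X] [NormedSpace ℝ X]
    [NormedAddCommGroup Y] [InnerProductSpace ℝ Y]

theorem aestronglyMeasurable_historyOp [CompleteSpace X] [CompleteSpace Y] {T : ℝ} (hT : 0 < T)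
    (B : sobolevW1 1 T (Y →L[ℝ] X)) (y₀ : X) (r : Lp Y 2 (timeMeasure T)) :
    AEStronglyMeasurable (historyOp B y₀ (h10Val (h10OfRate hT r))) (timeMeasure T) := by
  obtain ⟨M, hM, hB⟩ := exists_ae_bound_of_mem_sobolevW1 hT B
  have hr := integrable_Lp_timeMeasure r
  have hle : ∀ s ∈ Set.Icc 0 T, ∀ t ∈ Set.Icc 0 T, s ≤ t →
      dist (historyOp B y₀ (primitive (timeMeasure T) r) t)
        (historyOp B y₀ (primitive (timeMeasure T) r) s)
      ≤ (M * ∫ u, ‖r u‖ ∂(timeMeasure T)) * dist t s := by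
    intro s hs t ht hst
    rw [dist_eq_norm, Real.dist_eq, abs_of_nonneg (sub_nonneg.2 hst)]
    refine (norm_historyOp_sub_le B y₀ hM hB hr hs.1 hst ht.2).trans ?_
    rw [mul_right_comm]
    have h1 : primitive (timeMeasure T) (fun u => ‖r u‖) t ≤ ∫ u, ‖r u‖ ∂(timeMeasure T) :=
      setIntegral_le_integral hr.norm (Eventually.of_forall fun _ => norm_nonneg _)
    have := sub_nonneg.2 hst
    gcongr
  have hnn : 0 ≤ M * ∫ u, ‖r u‖ ∂(timeMeasure T) :=
    mul_nonneg hM (integral_nonneg fun _ => norm_nonneg _)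
  have hlip : LipschitzOnWith ⟨_, hnn⟩ (historyOp B y₀ (primitive (timeMeasure T) r))
      (Set.Icc 0 T) := by
    refine LipschitzOnWith.of_dist_le_mul fun s hs t ht => ?_
    rcases le_total s t with h | h
    · rw [dist_comm, dist_comm s t]; exact hle s hs t ht h
    · exact hle t ht s hs h
  have hm := (hlip.continuousOn.mono Set.Ioo_subset_Icc_self).aestronglyMeasurable
    (μ := volume) measurableSet_Ioo
  refine hm.congr ?_
  filter_upwards [ae_restrict_mem measurableSet_Ioo] with t ht
  exact (historyOp_h10OfRate hT B y₀ r (Set.Ioo_subset_Icc_self ht)).symm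

/-- Testing the integrated inequality with the proximal point `v̇ = prox (H(q), -∂_q E + q̇)` yields
`‖q̇ - v̇‖² ≤ 0`, and a fixed point of the proximal map solves the inclusion. -/
theorem subgradient_of_integrated [CompleteSpace X] [CompleteSpace Y] {T : ℝ} (hT : 0 < T) {R : X → Y → ℝ≥0∞}
    {D : Set Y} (hR : IsDissipation R D) (B : sobolevW1 1 T (Y →L[ℝ] X)) (y₀ : X)
    {r F : Lp Y 2 (timeMeasure T)}
    (h : ∀ v ∈ admissible T D, totalDissipation R B y₀ (h10OfRate hT r) v ≠ ⊤ →
      totalDissipation R B y₀ (h10OfRate hT r) (h10OfRate hT r) ≠ ⊤ ∧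
      (totalDissipation R B y₀ (h10OfRate hT r) (h10OfRate hT r)).toReal
          + inner ℝ F (v.1.snd - r)
        ≤ (totalDissipation R B y₀ (h10OfRate hT r) v).toReal) :
    ∀ᵐ t ∂(timeMeasure T), r t ∈ D ∧ ∀ v ∈ D,
      (R (historyOp B y₀ (h10Val (h10OfRate hT r)) t) (r t)).toReal + inner ℝ (F t) (v - r t)
        ≤ (R (historyOp B y₀ (h10Val (h10OfRate hT r)) t) v).toReal := by
  set H := historyOp B y₀ (h10Val (h10OfRate hT r)) with hH
  have hHm : AEStronglyMeasurable H (timeMeasure T) := aestronglyMeasurable_historyOp hT B y₀ r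
  -- The test function `0` shows that the dissipation of the limit is finite.
  have h0rate : ⇑(0 : Lp Y 2 (timeMeasure T)) =ᵐ[timeMeasure T] 0 := Lp.coeFn_zero _ _ _
  have h0 : totalDissipation R B y₀ (h10OfRate hT r) (h10OfRate hT 0) = 0 := by
    rw [totalDissipation, ← lintegral_zero (μ := timeMeasure T)]
    refine lintegral_congr_ae ?_
    filter_upwards [h0rate] with t ht
    rw [h10Rate_h10OfRate, ht, Pi.zero_apply, hR.apply_zero]
  have h0adm : h10OfRate hT (0 : Lp Y 2 (timeMeasure T)) ∈ admissible T D := by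
    filter_upwards [h0rate] with t ht
    rw [h10Rate_h10OfRate, ht]
    exact hR.zero_mem
  have hfin := (h _ h0adm (by rw [h0]; exact ENNReal.zero_ne_top)).1
  have hrD : ∀ᵐ t ∂(timeMeasure T), r t ∈ D := by
    have hm : AEMeasurable (fun t => R (H t) (r t)) (timeMeasure T) :=
      hR.aemeasurable_comp hHm (Lp.aestronglyMeasurable r)
    filter_upwards [ae_lt_top' hm hfin] with t ht using hR.ne_top_iff.1 ht.ne
  set p : ℝ → X × Y := fun t => (H t, (F + r : Lp Y 2 (timeMeasure T)) t) with hp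
  have hvm : MemLp (fun t => hR.prox (p t)) 2 (timeMeasure T) :=
    (Lp.memLp (F + r)).of_le (hR.continuous_prox.comp_aestronglyMeasurable
      (hHm.prodMk (Lp.aestronglyMeasurable _))) (Eventually.of_forall fun t => hR.norm_prox_le (p t))
  set v : Lp Y 2 (timeMeasure T) := hvm.toLp with hv
  have hvp : v =ᵐ[timeMeasure T] fun t => hR.prox (p t) := hvm.coeFn_toLp
  have hvadm : h10OfRate hT v ∈ admissible T D := by
    filter_upwards [hvp] with t ht
    rw [h10Rate_h10OfRate, ht]
    exact hR.prox_mem _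
  obtain ⟨hvfin, hvle⟩ := lintegral_add_integral_le (μ := timeMeasure T)
    (f := fun t => R (H t) (v t)) (g := fun t => R (H t) (r t))
    (h := fun t => inner ℝ ((F + r - v : Lp Y 2 (timeMeasure T)) t)
      ((r - v : Lp Y 2 (timeMeasure T)) t)) (L2.integrable_inner _ _) (by
      filter_upwards [hrD, hvp, Lp.coeFn_sub (F + r) v, Lp.coeFn_sub r v] with t h1 h2 h3 h4
      rw [h3, h4, Pi.sub_apply, Pi.sub_apply, h2]
      exact ⟨hR.ne_top_iff.2 (hR.prox_mem _), hR.ne_top_iff.2 h1, hR.prox_spec (p t) h1⟩) hfin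
  have hle := (h _ hvadm hvfin).2
  have hsq : inner ℝ (r - v) (r - v) ≤ (0 : ℝ) := by
    have h1 : (∫⁻ t, R (H t) (v t) ∂(timeMeasure T)).toReal + inner ℝ (F + r - v) (r - v)
        ≤ (∫⁻ t, R (H t) (r t) ∂(timeMeasure T)).toReal := hvle
    have h2 : (∫⁻ t, R (H t) (r t) ∂(timeMeasure T)).toReal + inner ℝ F (v - r)
        ≤ (∫⁻ t, R (H t) (v t) ∂(timeMeasure T)).toReal := hle
    rw [add_sub_assoc, inner_add_left] at h1
    rw [← neg_sub r v, inner_neg_right] at h2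
    linarith
  have hrv : r = v := sub_eq_zero.1 (real_inner_self_nonpos.1 hsq)
  rw [← hrv] at hvp
  filter_upwards [hrD, hvp, Lp.coeFn_add F r] with t h1 h2 h3
  refine ⟨h1, fun z hz => ?_⟩
  have h4 := hR.prox_spec (p t) hz
  rw [← h2] at h4
  simp only [hp, h3, Pi.add_apply, add_sub_cancel_right] at h4
  exact h4

theorem neg_fderiv_energy {A : Y →L[ℝ] Y} (hA : ∀ x y : Y, inner ℝ (A x) y = inner ℝ x (A y))
    (l : ℝ → StrongDual ℝ Y) (t : ℝ) (x : Y) :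
    -fderiv ℝ (energy A l t) x = l t - innerSL ℝ (A x) := by
  have h1 := ((A.hasFDerivAt (x := x)).inner ℝ (hasFDerivAt_id x)).const_mul (1 / 2 : ℝ)
  have h2 : HasFDerivAt (energy A l t) _ x := h1.sub (l t).hasFDerivAt
  rw [h2.fderiv]
  ext y
  simp only [neg_apply, sub_apply, innerSL_apply_apply, smul_apply,
    ContinuousLinearMap.comp_apply, ContinuousLinearMap.prod_apply, fderivInnerCLM_apply,
    ContinuousLinearMap.id_apply, id, smul_eq_mul]
  rw [hA y x, real_inner_comm (A x) y]
  ring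

theorem mem_subdiffTwo_of_le {R : X → Y → ℝ≥0∞} {D : Set Y}
    (hR : IsDissipation R D) {ζ : X} {η : Y} (hη : η ∈ D) {ξ : StrongDual ℝ Y}
    (h : ∀ v ∈ D, (R ζ η).toReal + ξ (v - η) ≤ (R ζ v).toReal) : ξ ∈ subdiffTwo R ζ η := by
  intro v
  by_cases hv : v ∈ D
  · have h1 := h v hv
    dsimp only
    rw [← EReal.coe_ennreal_toReal (hR.ne_top_iff.2 hη), ← EReal.coe_ennreal_toReal
      (hR.ne_top_iff.2 hv), ← EReal.coe_add, EReal.coe_le_coe_iff]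
    exact h1
  · have h1 : R ζ v = ⊤ := by
      by_contra h2
      exact hv (hR.ne_top_iff.1 h2)
    simp [h1]

end conclusion

theorem theorem4p1 {X Y : Type*}
    [NormedAddCommGroup X] [NormedSpace ℝ X] [CompleteSpace X]
    [NormedAddCommGroup Y] [InnerProductSpace ℝ Y] [CompleteSpace Y]
    (T : ℝ) (hT : 0 < T)
    (A : Y →L[ℝ] Y) (hA : IsSelfAdjoint A)
    (α : ℝ) (hα : 0 < α) (hcoercive : ∀ y : Y, α * ‖y‖ ^ 2 ≤ inner ℝ (A y) y)
    (R : X → Y → ℝ≥0∞) (D : Set Y) (hR : IsDissipation R D)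
    (B : sobolevW1 1 T (Y →L[ℝ] X)) (y₀ : X)
    (hconv : ConvergenceAssumption R D B y₀)
    (l : ℝ → StrongDual ℝ Y) (hl : MemH1 T l) (hcomp : l ∈ compatibleLoads T R y₀) :
    ∃ q : sobolevH10 T Y, ∀ᵐ t ∂(timeMeasure T),
      -fderiv ℝ (energy A l t) (h10Val q t)
        ∈ subdiffTwo R (historyOp B y₀ (h10Val q) t) (h10Rate q t) := by
  obtain ⟨hlc, hl0⟩ := hcomp
  obtain ⟨g, hg, hlg⟩ := exists_norm_sub_le_of_memH1 hT hl hlc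
  obtain ⟨f, hf⟩ := exists_Lp_inner_eq_of_memH1 hl
  have hcomp : ∀ v ∈ D, l 0 v ≤ (R y₀ v).toReal := by
    intro v hv
    have h := hl0 v
    dsimp only at h
    rw [hR.apply_zero, sub_zero, EReal.coe_ennreal_zero, zero_add,
      ← EReal.coe_ennreal_toReal (hR.ne_top_iff.2 hv), EReal.coe_le_coe_iff] at h
    exact h
  obtain ⟨r, hr⟩ := exists_solution_integrated hT hA hα hcoercive hR B y₀ hconv hg hlg hcomp hf
  refine ⟨h10OfRate hT r, ?_⟩
  filter_upwards [subgradient_of_integrated hT hR B y₀ hr, drivingForce_eq_inner hT.le A hf r,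
    h10Val_h10OfRate hT r] with t h1 h2 h3
  rw [neg_fderiv_energy (fun x y => hA.isSymmetric x y), h3, h10Rate_h10OfRate]
  refine mem_subdiffTwo_of_le hR h1.1 fun v hv => ?_
  have h4 := h1.2 v hv
  rw [← h2] at h4
  exact h4
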